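/- Let $M\ge 2$ and consider a continuous-variable system of $M$ modes with Hilbert space $L^2(\mathbb{R}^M)$, annihilation operators $a_m=(x_m+\partial_{x_m})/\sqrt2$ (closures of their restrictions to Schwartz functions), displacement operators $D(\vec\alpha)=\exp\bigl(\sum_m(\alpha_m a_m^\dagger-\alpha_m^* a_m)\bigr)$ for $\vec\alpha\in\mathbb{C}^M$, parity operator $\Pi=\exp\bigl(-i\pi\sum_m a_m^\dagger a_m\bigr)$, i.e. $(\Pi\psi)(x)=\psi(-x)$, and displaced parity operators $\Pi(\vec\alpha)=D(\vec\alpha)\,\Pi\,D(\vec\alpha)^\dagger$. A state is a positive operator of trace one. A state $\rho$ is genuinely multipartite entangled (GME) if it is not of the form $\rho=\sum_k p_k\,\rho_{A_k}\otimes\rho_{\bar A_k}$ (a finite or countable sum), where $p_k\ge 0$, $\sum_k p_k=1$, each $(A_k|\bar A_k)$ is a bipartition of the $M$ modes into two nonempty sets, and $\rho_{A_k}$, $\rho_{\bar A_k}$ are states of the modes in $A_k$ and in $\bar A_k$ respectively. Let $\rho$ be a state whose total energy satisfies $\sum_{m=1}^M \operatorname{tr}[\rho\,a_m^\dagger a_m]\le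 E$ with $0\le E<\infty$. Let $\Delta>0$ be a grid spacing, let $\mathcal S\subseteq\mathbb{Z}^2$, let $\vec 1=(1,\dots,1)\in\mathbb{C}^M$, and define (with values in $[0,\infty]$) $$I(\rho,\Delta;\mathcal S)=\sum_{(n_R,n_I)\in\mathcal S}\Delta^2\,\bigl|\operatorname{tr}\bigl[\rho\,\Pi\bigl((n_R+i n_I)\Delta\,\vec 1\bigr)\bigr]\bigr|,$$ $$\delta I(\Delta;\mathcal S,E)=\sum_{(n_R,n_I)\in\mathcal S}\Bigl[2\Delta^3\sqrt{2ME}+2M\Delta^4\Bigl(1+\sqrt{2(n_R^2+n_I^2)}\Bigr)\Bigr].$$ If $\delta I(\Delta;\mathcal S,E)<\infty$ (equivalently, $\mathcal S$ is finite) and $$I(\rho,\Delta;\mathcal S)-\delta I(\Delta;\mathcal S,E)>\frac{\pi}{4\sqrt{M-1}},$$ then $\rho$ is GME. -/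

import Mathlib

open MeasureTheory
open scoped ENNReal InnerProductSpace ComplexConjugate

noncomputable section

namespace CVSystem

/-! ### Trace and states on a Hilbert space -/

section Hilbert

variable {H : Type} [NormedAddCommGroup H] [InnerProductSpace ℂ H] [CompleteSpace H]

variable (H) in
/-- A fixed orthonormal basis of the Hilbert space; none of the notions below depends on
which one it is. -/
def basis : HilbertBasis (exists_hilbertBasis ℂ H).choose ℂ H :=
  (exists_hilbertBasis ℂ H).choose_spec.choose

/-- The trace `∑ᵢ ⟨eᵢ, T eᵢ⟩` (of trace class operators). -/
def trace (T : H →L[ℂ] H) : ℂ := ∑' i, ⟪basis H i, T (basis H i)⟫_ℂ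

/-- Density operators: positive operators with trace one. -/
def IsState (ρ : H →L[ℂ] H) : Prop := ρ.IsPositive ∧ trace ρ = 1

/-- The positive square root of a positive operator. -/
def sqrtOp (ρ : H →L[ℂ] H) : H →L[ℂ] H := CFC.sqrt ρ

end Hilbert

/-! ### Continuous-variable systems in the Schroedinger representation -/

/-- Configuration (position) space of the modes `ι`. -/
abbrev Config (ι : Type) : Type := ι → ℝ

/-- The Hilbert space `L²(ℝ^ι; ℂ)` of a system with a finite set `ι` of modes. -/
abbrev Space (ι : Type) [Fintype ι] : Type := Lp ℂ 2 (volume : Measure (Config ι))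

/-- Bounded operators on the Hilbert space of the modes `ι`. -/
abbrev Op (ι : Type) [Fintype ι] : Type := Space ι →L[ℂ] Space ι

section Operators

variable {ι : Type} [Fintype ι]

/-- The differential expression of the annihilation operator of mode `m`,
`a_m = (x_m + ∂/∂x_m) / √2`. -/
def annihilationExpr [DecidableEq ι] (m : ι) (η : Config ι → ℂ) (x : Config ι) : ℂ :=
  ((x m : ℂ) * η x + fderiv ℝ η x (Pi.single m 1)) / (Real.sqrt 2 : ℂ)

/-- The graph of `a_m` restricted to Schwartz functions. -/
def annihilationCore [DecidableEq ι] (m : ι) : Set (Space ι × Space ι) :=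
  {ψφ | ∃ η : SchwartzMap (Config ι) ℂ,
    (ψφ.1 : Config ι → ℂ) =ᵐ[volume] η ∧
    (ψφ.2 : Config ι → ℂ) =ᵐ[volume] annihilationExpr m η}

/-- The graph of the annihilation operator `a_m`, the closure of its restriction to
Schwartz functions: `(ψ, φ)` belongs to it iff `ψ` is in the domain of `a_m` and `a_m ψ = φ`. -/
def annihilationGraph [DecidableEq ι] (m : ι) : Set (Space ι × Space ι) :=
  closure (annihilationCore m)

/-- `⟨ψ, a_m† a_m ψ⟩ = ‖a_m ψ‖²`, which is `∞` if `ψ` is not in the domain of `a_m`. -/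
def numberForm [DecidableEq ι] (m : ι) (ψ : Space ι) : ℝ≥0∞ :=
  ⨅ (φ : Space ι) (_ : (ψ, φ) ∈ annihilationGraph m), ‖φ‖ₑ ^ 2

/-- The phase factor `exp (i ∑ₘ (√2 Im αₘ xₘ - Re αₘ Im αₘ))`. -/
def displacementPhase (α : ι → ℂ) (x : Config ι) : ℂ :=
  Complex.exp (Complex.I *
    ((∑ m, (Real.sqrt 2 * (α m).im * x m - (α m).re * (α m).im) : ℝ) : ℂ))

/-- The displacement of positions by `√2 Re α`. -/
def displacementShift (α : ι → ℂ) : Config ι := fun m => Real.sqrt 2 * (α m).re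

lemma norm_displacementPhase (α : ι → ℂ) (x : Config ι) : ‖displacementPhase α x‖ = 1 := by
  rw [displacementPhase, mul_comm, Complex.norm_exp_ofReal_mul_I]

lemma continuous_displacementPhase (α : ι → ℂ) : Continuous (displacementPhase α) := by
  unfold displacementPhase
  fun_prop

lemma measurePreserving_shift (v : Config ι) :
    MeasurePreserving (fun x : Config ι => x - v) volume volume :=
  measurePreserving_sub_right volume v

/-- Multiplication of a wave function by the phase factor. -/
def phaseOp (α : ι → ℂ) : Op ι :=
  LinearMap.mkContinuous
    { toFun := fun ψ => MemLp.toLp (fun x => displacementPhase α x * ψ x)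
        ((Lp.memLp ψ).of_le
          ((continuous_displacementPhase α).aestronglyMeasurable.mul
            (Lp.aestronglyMeasurable ψ))
          (Filter.Eventually.of_forall fun x => by
            rw [norm_mul, norm_displacementPhase, one_mul]))
      map_add' := fun ψ φ => by
        rw [← MemLp.toLp_add]
        refine MemLp.toLp_congr _ _ ?_
        filter_upwards [Lp.coeFn_add ψ φ] with x hx
        rw [Pi.add_apply]
        simp only [hx, Pi.add_apply, mul_add]
      map_smul' := fun c ψ => by
        rw [RingHom.id_apply, ← MemLp.toLp_const_smul]
        refine MemLp.toLp_congr _ _ ?_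
        filter_upwards [Lp.coeFn_smul c ψ] with x hx
        simp [hx, mul_left_comm] }
    1 (fun ψ => by
      rw [one_mul]
      refine Lp.norm_le_norm_of_ae_le ?_
      filter_upwards [MemLp.coeFn_toLp (p := 2) (μ := (volume : Measure (Config ι)))
        (f := fun x => displacementPhase α x * ψ x)
        ((Lp.memLp ψ).of_le
          ((continuous_displacementPhase α).aestronglyMeasurable.mul
            (Lp.aestronglyMeasurable ψ))
          (Filter.Eventually.of_forall fun x => by
            rw [norm_mul, norm_displacementPhase, one_mul]))] with x hx
      simp only [LinearMap.coe_mk, AddHom.coe_mk]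
      rw [hx, norm_mul, norm_displacementPhase, one_mul])

/-- Translation of a wave function, `ψ ↦ ψ (· - v)`. -/
def shiftOp (v : Config ι) : Op ι :=
  (Lp.compMeasurePreservingₗᵢ ℂ (fun x : Config ι => x - v)
    (measurePreserving_shift v)).toContinuousLinearMap

/-- The displacement operator `D(α) = exp (∑ₘ (αₘ aₘ† - conj αₘ aₘ))`, which in the
Schroedinger representation acts as
`(D(α) ψ)(x) = exp (i ∑ₘ (√2 Im αₘ xₘ - Re αₘ Im αₘ)) ψ(x - √2 Re α)`. -/
def displacement (α : ι → ℂ) : Op ι :=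
  phaseOp α ∘L shiftOp (displacementShift α)

/-- The displacement operator acts on wave functions as described. -/
lemma displacement_coeFn (α : ι → ℂ) (ψ : Space ι) :
    (displacement α ψ : Config ι → ℂ) =ᵐ[volume]
      fun x => displacementPhase α x * ψ (x - displacementShift α) := by
  have h1 := Lp.coeFn_compMeasurePreserving ψ (measurePreserving_shift (displacementShift α))
  have h2 := MemLp.coeFn_toLp
    ((Lp.memLp (shiftOp (displacementShift α) ψ)).of_le
      ((continuous_displacementPhase α).aestronglyMeasurable.mul
        (Lp.aestronglyMeasurable (shiftOp (displacementShift α) ψ)))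
      (Filter.Eventually.of_forall fun x => by
        rw [Pi.mul_apply, norm_mul, norm_displacementPhase, one_mul]))
  refine Filter.EventuallyEq.trans h2 ?_
  filter_upwards [h1] with x hx
  exact congrArg (displacementPhase α x * ·) hx

/-- The parity operator `Π = exp (-i π ∑ₘ aₘ† aₘ)`, which in the Schroedinger representation
acts as `(Π ψ)(x) = ψ(-x)`. -/
def parity (ι : Type) [Fintype ι] : Op ι :=
  (Lp.compMeasurePreservingₗᵢ ℂ (fun x : Config ι => -x)
    (Measure.measurePreserving_neg volume)).toContinuousLinearMap

/-- The displaced parity operator `Π(α) = D(α) Π D(α)†`. -/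
def displacedParity (α : ι → ℂ) : Op ι :=
  displacement α ∘L parity ι ∘L ContinuousLinearMap.adjoint (displacement α)

/-! ### Energy -/

/-- The mean excitation number `tr[ρ a_m† a_m] = tr[√ρ a_m† a_m √ρ] = ∑ᵢ ‖a_m √ρ eᵢ‖²`
of mode `m` in the state `ρ`, as an element of `[0, ∞]`. -/
def meanNumber [DecidableEq ι] (ρ : Op ι) (m : ι) : ℝ≥0∞ :=
  ∑' i, numberForm m (sqrtOp ρ (basis (Space ι) i))

/-- The total energy `∑ₘ tr[ρ a_m† a_m]`. -/
def totalEnergy [DecidableEq ι] (ρ : Op ι) : ℝ≥0∞ := ∑ m, meanNumber ρ m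

end Operators

/-! ### Genuine multipartite entanglement -/

section Entanglement

variable {ι : Type} [Fintype ι] [DecidableEq ι]

lemma memLp_prodFun (A : Finset ι) (u : Space {m // m ∈ A}) (v : Space {m // m ∉ A}) :
    MemLp (fun x : Config ι => u (fun m => x m) * v (fun m => x m)) 2 volume := by
  have hmp : MeasurePreserving (fun x : Config ι =>
      ((fun m => x m : Config {m // m ∈ A}), (fun m => x m : Config {m // m ∉ A})))
      volume ((volume : Measure (Config {m // m ∈ A})).prod volume) := by
    convert! volume_preserving_piEquivPiSubtypeProd (fun _ : ι => ℝ) (fun m => m ∈ A)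
    rw [Measure.volume_eq_prod]
    congr!
  have hprod : MemLp (fun z : Config {m // m ∈ A} × Config {m // m ∉ A} => u z.1 * v z.2) 2
      ((volume : Measure (Config {m // m ∈ A})).prod volume) := by
    refine (memLp_two_iff_integrable_sq_norm
      ((Lp.aestronglyMeasurable u).comp_fst.mul (Lp.aestronglyMeasurable v).comp_snd)).2 ?_
    simp only [Pi.mul_apply]
    simp only [norm_mul, mul_pow]
    exact Integrable.mul_prod
      ((memLp_two_iff_integrable_sq_norm (Lp.aestronglyMeasurable u)).1 (Lp.memLp u))
      ((memLp_two_iff_integrable_sq_norm (Lp.aestronglyMeasurable v)).1 (Lp.memLp v))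
  exact hprod.comp_measurePreserving hmp

/-- The product wave function `(u ⊗ v)(x) = u(x_A) v(x_Ā)`. -/
def prodVec (A : Finset ι) (u : Space {m // m ∈ A}) (v : Space {m // m ∉ A}) : Space ι :=
  (memLp_prodFun A u v).toLp _

/-- `σ` is the operator `σA ⊗ σB` for the bipartition `(A | Ā)` of the modes. It is determined
by its action on product vectors, since these span a dense subspace. -/
def IsTensor (A : Finset ι) (σA : Op {m // m ∈ A}) (σB : Op {m // m ∉ A}) (σ : Op ι) : Prop :=
  ∀ u v, σ (prodVec A u v) = prodVec A (σA u) (σB v)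

/-- `σ = ρ_A ⊗ ρ_Ā` for some bipartition of the modes into two nonempty sets, and states
`ρ_A`, `ρ_Ā` of the two parts. -/
def IsProductState (σ : Op ι) : Prop :=
  ∃ A : Finset ι, A.Nonempty ∧ Aᶜ.Nonempty ∧
    ∃ (σA : Op {m // m ∈ A}) (σB : Op {m // m ∉ A}),
      IsState σA ∧ IsState σB ∧ IsTensor A σA σB σ

/-- `ρ` is a (finite or countable) statistical mixture of product states, each of them with
respect to a bipartition of its own. -/
def IsBiseparableMixture (ρ : Op ι) : Prop :=
  ∃ (p : ℕ → ℝ) (σ : ℕ → Op ι),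
    (∀ k, 0 ≤ p k) ∧ HasSum p 1 ∧ (∀ k, IsProductState (σ k)) ∧
      HasSum (fun k => (p k : ℂ) • σ k) ρ

/-- Genuine multipartite entanglement: `ρ` is a state that is not a mixture of states which
are products with respect to some bipartition. -/
def IsGME (ρ : Op ι) : Prop := IsState ρ ∧ ¬ IsBiseparableMixture ρ

end Entanglement

/-! ### The discretised integral and its error term -/

/-- The point `(n_R + i n_I) Δ (1, …, 1)` of the slice `α (1, …, 1)`. -/
def gridPoint (M : ℕ) (Δ : ℝ) (n : ℤ × ℤ) : Fin M → ℂ :=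
  fun _ => ((n.1 : ℂ) + Complex.I * (n.2 : ℂ)) * (Δ : ℂ)

/-- `I(ρ, Δ; S) = ∑_{n ∈ S} Δ² |tr[ρ Π((n_R + i n_I) Δ (1, …, 1))]|`, in `[0, ∞]`. -/
def discreteIntegral {M : ℕ} (ρ : Op (Fin M)) (Δ : ℝ) (S : Set (ℤ × ℤ)) : ℝ≥0∞ :=
  ∑' n : S, ENNReal.ofReal (Δ ^ 2 * ‖trace (ρ ∘L displacedParity (gridPoint M Δ n))‖)

/-- `δI(Δ; S, E) = ∑_{n ∈ S} [2 Δ³ √(2 M E) + 2 M Δ⁴ (1 + √(2 (n_R² + n_I²)))]`, in `[0, ∞]`;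
it is finite exactly if `S` is finite (for `Δ > 0` and `M > 0`). -/
def discreteError (M : ℕ) (Δ : ℝ) (S : Set (ℤ × ℤ)) (E : ℝ) : ℝ≥0∞ :=
  ∑' n : S, ENNReal.ofReal (2 * Δ ^ 3 * Real.sqrt (2 * M * E) +
    2 * M * Δ ^ 4 * (1 + Real.sqrt (2 * (((n : ℤ × ℤ).1 : ℝ) ^ 2 + ((n : ℤ × ℤ).2 : ℝ) ^ 2))))

end CVSystem

end

/-!
A biseparable state is an ensemble `∑ᵢ |ψᵢ⟩⟨ψᵢ|` of vectors `ψᵢ`, each of which is a product with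
respect to some bipartition of the modes. The expectation value `⟨ψ, Π(α) ψ⟩` is the Wigner function
of `ψ` up to normalisation, so it factorises for product vectors. On the slice `α (1, …, 1)`, the
Wigner function of a vector `u` of `k` modes has squared `L²` norm at most `π / (4 k) ‖u‖⁴`:
Plancherel in `Im α`, regularised by a Gaussian, expresses it through four copies of `u`, which are
paired up by the inequality of arithmetic and geometric means. By Cauchy–Schwarz, a product vector
with `k` modes on one side contributes at most `π / (4 √(k (M - k))) ≤ π / (4 √(M - 1))` times its
squared norm to the slice integral of `|tr[ρ Π(α)]|`.

The relation `Π(α) aₘ = (2 αₘ - aₘ) Π(α)` makes `⟨ψ, Π(α) ψ⟩` Lipschitz in `αₘ`, with constant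
`4 (‖ψ‖ ‖aₘ ψ‖ + |αₘ| ‖ψ‖²)`. Summing over the ensemble and the modes bounds the variation of
`tr[ρ Π(α (1, …, 1))]` over a grid cell through the total energy, so that the grid sum exceeds the
integral by at most the error term.
-/

noncomputable section

namespace CVSystem

/-! ### Ensembles of vectors -/

section Ensemble

variable {𝕜 H κ w : Type*} [RCLike 𝕜] [NormedAddCommGroup H]

section HilbertBasis

variable [InnerProductSpace 𝕜 H]

lemma hasSum_sq_norm_inner (b : HilbertBasis w 𝕜 H) (x : H) :
    HasSum (fun i => ‖⟪b i, x⟫_𝕜‖ ^ 2) (‖x‖ ^ 2) := by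
  simpa [b.repr_apply_apply] using lp.hasSum_norm (p := 2) (by simp) (b.repr x)

lemma summable_sq_norm_inner (b : HilbertBasis w 𝕜 H) {ψ : κ → H}
    (hψ : Summable fun i => ‖ψ i‖ ^ 2) :
    Summable fun p : κ × w => ‖⟪b p.2, ψ p.1⟫_𝕜‖ ^ 2 := by
  refine (summable_prod_of_nonneg fun _ => sq_nonneg _).2 ⟨fun i => ?_, ?_⟩
  · exact (hasSum_sq_norm_inner b (ψ i)).summable
  · simpa only [(hasSum_sq_norm_inner b _).tsum_eq] using hψ

lemma summable_inner_mul_inner (b : HilbertBasis w 𝕜 H) {ψ φ : κ → H}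
    (hψ : Summable fun i => ‖ψ i‖ ^ 2) (hφ : Summable fun i => ‖φ i‖ ^ 2) :
    Summable fun p : κ × w => ⟪φ p.1, b p.2⟫_𝕜 * ⟪b p.2, ψ p.1⟫_𝕜 := by
  refine Summable.of_norm_bounded
    ((summable_sq_norm_inner b hφ).add (summable_sq_norm_inner b hψ)) fun p => ?_
  rw [norm_mul, norm_inner_symm]
  nlinarith [two_mul_le_add_sq ‖⟪b p.2, φ p.1⟫_𝕜‖ ‖⟪b p.2, ψ p.1⟫_𝕜‖,
    mul_nonneg (norm_nonneg ⟪b p.2, φ p.1⟫_𝕜) (norm_nonneg ⟪b p.2, ψ p.1⟫_𝕜)]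

end HilbertBasis

variable [InnerProductSpace ℂ H]

/-- The operator `T` is the ensemble `∑ᵢ |ψᵢ⟩⟨ψᵢ|` of the vectors `ψᵢ`, whose squared norms are
the (unnormalised) weights of the ensemble and are required to be summable. -/
def IsEnsemble (T : H →L[ℂ] H) (ψ : κ → H) : Prop :=
  Summable (fun i => ‖ψ i‖ ^ 2) ∧ HasSum (fun i => InnerProductSpace.rankOne ℂ (ψ i) (ψ i)) T

namespace IsEnsemble

variable {T : H →L[ℂ] H} {ψ : κ → H}

lemma hasSum_inner (h : IsEnsemble T ψ) (x y : H) :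
    HasSum (fun i => ⟪x, ψ i⟫_ℂ * ⟪ψ i, y⟫_ℂ) ⟪x, T y⟫_ℂ := by
  simpa [inner_smul_right, mul_comm] using
    (h.2.mapL (ContinuousLinearMap.apply ℂ H y)).mapL (innerSL ℂ x)

lemma of_summable [CompleteSpace H] (hψ : Summable fun i => ‖ψ i‖ ^ 2) :
    IsEnsemble (∑' i, InnerProductSpace.rankOne ℂ (ψ i) (ψ i)) ψ :=
  ⟨hψ, (Summable.of_norm (by simpa [← pow_two] using hψ)).hasSum⟩

lemma of_hasSum_inner [CompleteSpace H] (hψ : Summable fun i => ‖ψ i‖ ^ 2)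
    (hT : ∀ x y, HasSum (fun i => ⟪x, ψ i⟫_ℂ * ⟪ψ i, y⟫_ℂ) ⟪x, T y⟫_ℂ) : IsEnsemble T ψ := by
  suffices T = ∑' i, InnerProductSpace.rankOne ℂ (ψ i) (ψ i) from this ▸ of_summable hψ
  ext y
  exact ext_inner_left ℂ fun x => (hT x y).unique ((of_summable hψ).hasSum_inner x y)

lemma smul (h : IsEnsemble T ψ) {p : ℝ} (hp : 0 ≤ p) :
    IsEnsemble ((p : ℂ) • T) fun i => (√p : ℂ) • ψ i := by
  constructor
  · simpa [norm_smul, mul_pow, Real.sq_sqrt hp] using h.1.mul_left p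
  · convert h.2.const_smul (p : ℂ) using 2 with i
    ext x
    simp only [smul_apply, InnerProductSpace.rankOne_apply, inner_smul_left,
      Complex.conj_ofReal, smul_smul]
    rw [mul_right_comm, ← Complex.ofReal_mul, Real.mul_self_sqrt hp]

lemma sigma [CompleteSpace H] {ν : Type*} {κ : ν → Type*} {T : H →L[ℂ] H} {σ : ν → H →L[ℂ] H}
    {ψ : ∀ k, κ k → H} (hσ : ∀ k, IsEnsemble (σ k) (ψ k)) (hT : HasSum σ T)
    (hsum : Summable fun k => ∑' i, ‖ψ k i‖ ^ 2) :
    IsEnsemble T fun q : Σ k, κ k => ψ q.1 q.2 := by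
  have hψ : Summable fun q : Σ k, κ k => ‖ψ q.1 q.2‖ ^ 2 :=
    (summable_sigma_of_nonneg fun q => by positivity).2 ⟨fun k => (hσ k).1, hsum⟩
  refine ⟨hψ, ?_⟩
  have hsigma := (of_summable hψ).2
  rwa [(hsigma.sigma fun k => (hσ k).2).unique hT] at hsigma

lemma exists_countable (h : IsEnsemble T ψ) :
    ∃ s : Set κ, Countable s ∧ IsEnsemble T fun i : s => ψ i := by
  refine ⟨Function.support fun i => ‖ψ i‖ ^ 2, h.1.countable_support.to_subtype,
    h.1.subtype _, (hasSum_subtype_iff_of_support_subset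
      (f := fun i => InnerProductSpace.rankOne ℂ (ψ i) (ψ i)) fun i hi => ?_).2 h.2⟩
  contrapose! hi
  have hψi : ψ i = 0 := by simpa using hi
  simp [hψi]

end IsEnsemble

section Trace

variable {H : Type} [NormedAddCommGroup H] [InnerProductSpace ℂ H] [CompleteSpace H]
  {T : H →L[ℂ] H} {ψ : κ → H}

lemma IsEnsemble.hasSum_trace_comp (h : IsEnsemble T ψ) (B : H →L[ℂ] H) :
    HasSum (fun i => ⟪ψ i, B (ψ i)⟫_ℂ) (trace (T ∘L B)) := by
  set e := basis H
  have hadj : Summable fun i => ‖B.adjoint (ψ i)‖ ^ 2 := by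
    refine (h.1.mul_left (‖B.adjoint‖ ^ 2)).of_nonneg_of_le (fun i => by positivity) fun i => ?_
    rw [← mul_pow]
    gcongr
    exact B.adjoint.le_opNorm (ψ i)
  have hsum := (summable_inner_mul_inner e h.1 hadj).hasSum
  have hrows : HasSum (fun i => ⟪ψ i, B (ψ i)⟫_ℂ) _ := hsum.prod_fiberwise fun i => by
    simpa only [B.adjoint_inner_left] using e.hasSum_inner_mul_inner (B.adjoint (ψ i)) (ψ i)
  have hcols : HasSum (fun j => ⟪e j, (T ∘L B) (e j)⟫_ℂ) _ :=
    ((Equiv.prodComm _ _).hasSum_iff.2 hsum).prod_fiberwise fun j => by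
      simpa [B.adjoint_inner_left, mul_comm] using h.hasSum_inner (e j) (B (e j))
  rwa [show trace (T ∘L B) = _ from hcols.tsum_eq]

lemma IsEnsemble.enorm_trace_comp_le (h : IsEnsemble T ψ) (B : H →L[ℂ] H) :
    ‖trace (T ∘L B)‖ₑ ≤ ∑' i, ‖⟪ψ i, B (ψ i)⟫_ℂ‖ₑ := by
  rw [← (h.hasSum_trace_comp B).tsum_eq]
  exact enorm_tsum_le_tsum_enorm

lemma IsEnsemble.hasSum_sq_norm (h : IsEnsemble T ψ) (hT : trace T = 1) :
    HasSum (fun i => ‖ψ i‖ ^ 2) 1 := by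
  have hre := Complex.hasSum_re (h.hasSum_trace_comp (ContinuousLinearMap.id ℂ H))
  simp only [ContinuousLinearMap.comp_id, hT] at hre
  simpa [inner_self_eq_norm_sq_to_K, ← Complex.ofReal_pow] using hre

lemma IsEnsemble.tsum_sq_enorm (h : IsEnsemble T ψ) (hT : trace T = 1) :
    ∑' i, ‖ψ i‖ₑ ^ 2 = 1 := by
  simp_rw [← ofReal_norm, ← ENNReal.ofReal_pow (norm_nonneg _)]
  rw [← ENNReal.ofReal_tsum_of_nonneg (fun i => by positivity) h.1, (h.hasSum_sq_norm hT).tsum_eq,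
    ENNReal.ofReal_one]

lemma isSelfAdjoint_sqrtOp (T : H →L[ℂ] H) : IsSelfAdjoint (sqrtOp T) :=
  (CFC.sqrt_nonneg T).isSelfAdjoint

lemma inner_sqrtOp_sqrtOp (hT : T.IsPositive) (x y : H) :
    ⟪sqrtOp T x, sqrtOp T y⟫_ℂ = ⟪x, T y⟫_ℂ := by
  rw [← ContinuousLinearMap.adjoint_inner_right, (isSelfAdjoint_sqrtOp T).adjoint_eq,
    ← mul_apply_eq_comp, sqrtOp, CFC.sqrt_mul_sqrt_self T (T.nonneg_iff_isPositive.2 hT)]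

lemma IsState.isEnsemble_sqrtOp {ρ : H →L[ℂ] H} (hρ : IsState ρ) :
    IsEnsemble ρ fun i => sqrtOp ρ (basis H i) := by
  refine .of_hasSum_inner ?_ fun x y => ?_
  · have hdiag : Summable fun i => ⟪basis H i, ρ (basis H i)⟫_ℂ := by
      by_contra hnot
      exact zero_ne_one ((tsum_eq_zero_of_not_summable hnot).symm.trans hρ.2)
    simpa [← inner_sqrtOp_sqrtOp hρ.1, inner_self_eq_norm_sq_to_K, ← Complex.ofReal_pow]
      using (Complex.hasSum_re hdiag.hasSum).summable
  · have hbasis := (basis H).hasSum_inner_mul_inner (sqrtOp ρ x) (sqrtOp ρ y)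
    rw [inner_sqrtOp_sqrtOp hρ.1] at hbasis
    convert! hbasis using 2 with i
    rw [← ContinuousLinearMap.adjoint_inner_right, ← ContinuousLinearMap.adjoint_inner_left,
      (isSelfAdjoint_sqrtOp ρ).adjoint_eq]

lemma IsState.exists_isEnsemble {ρ : H →L[ℂ] H} (hρ : IsState ρ) :
    ∃ (κ : Type) (_ : Countable κ) (ψ : κ → H), IsEnsemble ρ ψ :=
  have ⟨s, hs, hψ⟩ := hρ.isEnsemble_sqrtOp.exists_countable
  ⟨s, hs, _, hψ⟩

end Trace

end Ensemble

/-! ### The Wigner function -/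

section Wigner

lemma displacementShift_neg {ι : Type} (α : ι → ℂ) :
    displacementShift (-α) = -displacementShift α := by
  ext m
  simp [displacementShift]

variable {ι : Type} [Fintype ι]

lemma conj_displacementPhase (α : ι → ℂ) (x : Config ι) :
    conj (displacementPhase α x) = displacementPhase (-α) (x - displacementShift α) := by
  rw [displacementPhase, displacementPhase, ← Complex.exp_conj, map_mul, Complex.conj_I,
    Complex.conj_ofReal, neg_mul, ← mul_neg, ← Complex.ofReal_neg, ← Finset.sum_neg_distrib]
  congr! 4 with m
  simp only [displacementShift, Pi.neg_apply, Pi.sub_apply, Complex.neg_re,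
    Complex.neg_im]
  linear_combination (-(α m).im * (α m).re) * Real.mul_self_sqrt (zero_le_two (α := ℝ))

lemma adjoint_displacement (α : ι → ℂ) :
    ContinuousLinearMap.adjoint (displacement α) = displacement (-α) := by
  refine ((ContinuousLinearMap.eq_adjoint_iff _ _).2 fun ψ φ => ?_).symm
  rw [L2.inner_def, L2.inner_def, ← integral_sub_right_eq_self _ (displacementShift α)]
  refine integral_congr_ae ?_
  filter_upwards [(measurePreserving_shift (displacementShift α)).quasiMeasurePreserving.ae_eq
    (displacement_coeFn (-α) ψ), displacement_coeFn α φ] with x hψ hφ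
  simp only [Function.comp_apply] at hψ
  rw [hψ, hφ, ← conj_displacementPhase, displacementShift_neg]
  simp only [RCLike.inner_apply, map_mul, Complex.conj_conj, sub_neg_eq_add, sub_add_cancel]
  ring

lemma parity_coeFn (ψ : Space ι) : (parity ι ψ : Config ι → ℂ) =ᵐ[volume] fun x => ψ (-x) :=
  Lp.coeFn_compMeasurePreserving ψ (Measure.measurePreserving_neg volume)

/-- The phase factor `exp (2√2 i ∑ₘ Im αₘ yₘ)` of the Wigner function. -/
def wignerPhase (α : ι → ℂ) (y : Config ι) : ℂ :=
  Complex.exp (Complex.I * ((2 * √2 * ∑ m, (α m).im * y m : ℝ) : ℂ))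

/-- The integrand of the cross Wigner function of `f` and `g` at the phase space point `α`, in
the position representation with centre `√2 Re α`. -/
def wignerKernel (α : ι → ℂ) (f g : Config ι → ℂ) (y : Config ι) : ℂ :=
  conj (f (displacementShift α + y)) * g (displacementShift α - y) * wignerPhase α y

/-- The Wigner function of `f`, normalised so as to be the expectation value of the displaced
parity operators, which is `(π / 2) ^ M` times the usual quasiprobability density. -/
def wigner (α : ι → ℂ) (f : Config ι → ℂ) : ℂ := ∫ y, wignerKernel α f f y

lemma norm_wignerPhase (α : ι → ℂ) (y : Config ι) : ‖wignerPhase α y‖ = 1 := by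
  rw [wignerPhase, mul_comm, Complex.norm_exp_ofReal_mul_I]

lemma continuous_wignerPhase (α : ι → ℂ) : Continuous (wignerPhase α) := by
  unfold wignerPhase
  fun_prop

lemma conj_displacementPhase_mul_displacementPhase_neg (α : ι → ℂ) (y : Config ι) :
    conj (displacementPhase (-α) y) * displacementPhase (-α) (-y) = wignerPhase α y := by
  rw [displacementPhase, displacementPhase, wignerPhase, ← Complex.exp_conj, ← Complex.exp_add,
    map_mul, Complex.conj_I, Complex.conj_ofReal, neg_mul, neg_add_eq_sub, ← mul_sub,
    ← Complex.ofReal_sub, ← Finset.sum_sub_distrib, Finset.mul_sum]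
  congr! 4 with m
  simp only [Pi.neg_apply, Complex.neg_re, Complex.neg_im]
  ring

lemma inner_displacedParity (α : ι → ℂ) (ψ : Space ι) :
    ⟪ψ, displacedParity α ψ⟫_ℂ = wigner α ψ := by
  set χ := displacement (-α) ψ with hχ
  have hparity : ⟪ψ, displacedParity α ψ⟫_ℂ = ⟪χ, parity ι χ⟫_ℂ := by
    rw [hχ, ← adjoint_displacement, ContinuousLinearMap.adjoint_inner_left]
    rfl
  have hcoe : (χ : Config ι → ℂ) =ᵐ[volume]
      fun y => displacementPhase (-α) y * ψ (y + displacementShift α) := by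
    simpa only [displacementShift_neg, sub_neg_eq_add] using displacement_coeFn (-α) ψ
  rw [hparity, L2.inner_def, wigner]
  refine integral_congr_ae ?_
  filter_upwards [hcoe, parity_coeFn χ, (Measure.measurePreserving_neg
    (volume : Measure (Config ι))).quasiMeasurePreserving.ae_eq hcoe] with y hy hparity hneg
  simp only [Function.comp_apply] at hneg
  rw [hparity, hneg, hy, wignerKernel, ← conj_displacementPhase_mul_displacementPhase_neg,
    RCLike.inner_apply, map_mul, add_comm y, neg_add_eq_sub]
  ring

lemma wigner_congr (α : ι → ℂ) {f g : Config ι → ℂ} (hfg : f =ᵐ[volume] g) :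
    wigner α f = wigner α g := by
  refine integral_congr_ae ?_
  filter_upwards [
    (measurePreserving_add_left volume (displacementShift α)).quasiMeasurePreserving.ae_eq hfg,
    (Measure.measurePreserving_sub_left volume
      (displacementShift α)).quasiMeasurePreserving.ae_eq hfg] with y hadd hsub
  simp only [Function.comp_apply] at hadd hsub
  rw [wignerKernel, wignerKernel, hadd, hsub]

lemma enorm_wignerKernel (α : ι → ℂ) (f g : Config ι → ℂ) (y : Config ι) :
    ‖wignerKernel α f g y‖ₑ =
      ‖f (displacementShift α + y)‖ₑ * ‖g (displacementShift α - y)‖ₑ := by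
  have hphase : ‖wignerPhase α y‖ₑ = 1 := by
    rw [← ofReal_norm, norm_wignerPhase, ENNReal.ofReal_one]
  rw [wignerKernel, enorm_mul, enorm_mul, hphase, mul_one, RCLike.enorm_conj]

lemma measurable_wignerKernel {X : Type*} [MeasurableSpace X] {α : X → ι → ℂ} (hα : Measurable α)
    {f g : Config ι → ℂ} (hf : Measurable f) (hg : Measurable g) :
    Measurable fun q : X × Config ι => wignerKernel (α q.1) f g q.2 := by
  unfold wignerKernel wignerPhase displacementShift
  fun_prop

lemma continuous_wignerKernel {X : Type*} [TopologicalSpace X] {α : X → ι → ℂ}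
    (hα : Continuous α) {f g : Config ι → ℂ} (hf : Continuous f) (hg : Continuous g) :
    Continuous fun q : X × Config ι => wignerKernel (α q.1) f g q.2 := by
  unfold wignerKernel wignerPhase displacementShift
  fun_prop

variable {f g : Config ι → ℂ}

lemma integrable_wignerKernel (hf : MemLp f 2 volume) (hg : MemLp g 2 volume) (α : ι → ℂ) :
    Integrable (wignerKernel α f g) := by
  have hfg : Integrable fun y =>
      conj (f (displacementShift α + y)) * g (displacementShift α - y) :=
    MemLp.integrable_mul (p := 2) (q := 2)
      (hf.comp_measurePreserving (measurePreserving_add_left volume _)).star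
      (hg.comp_measurePreserving (Measure.measurePreserving_sub_left volume _))
  refine hfg.mul_bdd (c := 1) ?_ (.of_forall fun y => (norm_wignerPhase α y).le)
  exact (continuous_wignerPhase α).aestronglyMeasurable

lemma lintegral_enorm_wignerKernel_le (hf : AEStronglyMeasurable f volume)
    (hg : AEStronglyMeasurable g volume) (α : ι → ℂ) :
    ∫⁻ y, ‖wignerKernel α f g y‖ₑ ≤ eLpNorm f 2 volume * eLpNorm g 2 volume := by
  have hadd := measurePreserving_add_left (volume : Measure (Config ι)) (displacementShift α)
  have hsub := Measure.measurePreserving_sub_left (volume : Measure (Config ι))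
    (displacementShift α)
  simp only [enorm_wignerKernel]
  rw [← eLpNorm_comp_measurePreserving hf hadd, ← eLpNorm_comp_measurePreserving hg hsub]
  simpa [eLpNorm_one_eq_lintegral_enorm, Pi.smul_def', enorm_mul] using
    eLpNorm_smul_le_mul_eLpNorm (p := 2) (q := 2) (r := 1)
    (hg.comp_measurePreserving hsub) (hf.comp_measurePreserving hadd)

end Wigner

/-! ### Gaussian-regularised Plancherel inequality -/

section Gaussian

/-- The Fourier transform `t ↦ ∫ exp (-ε b²) exp (i b t) db` of a Gaussian. -/
def gaussKernel (ε t : ℝ) : ℝ := √(Real.pi / ε) * Real.exp (-t ^ 2 / (4 * ε))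

lemma gaussKernel_nonneg (ε t : ℝ) : 0 ≤ gaussKernel ε t := by
  unfold gaussKernel
  positivity

lemma gaussKernel_neg (ε t : ℝ) : gaussKernel ε (-t) = gaussKernel ε t := by
  simp [gaussKernel]

@[fun_prop]
lemma measurable_gaussKernel (ε : ℝ) : Measurable (gaussKernel ε) := by
  unfold gaussKernel
  fun_prop

variable {ε : ℝ}

lemma integral_exp_neg_mul_sq_mul_cexp (hε : 0 < ε) (t : ℝ) :
    ∫ b : ℝ, (Real.exp (-ε * b ^ 2) : ℂ) * Complex.exp (Complex.I * ((b * t : ℝ) : ℂ)) =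
      gaussKernel ε t := by
  have hsqrt : (√(Real.pi / ε) : ℂ) = ((Real.pi : ℂ) / ε) ^ (1 / 2 : ℂ) := by
    rw [Real.sqrt_eq_rpow, Complex.ofReal_cpow (by positivity)]
    push_cast
    rfl
  rw [gaussKernel, Complex.ofReal_mul, hsqrt]
  convert fourierIntegral_gaussian (b := (ε : ℂ)) (by simpa using hε) t using 3 with b
  · rw [mul_comm]
    push_cast
    ring_nf
  · push_cast
    rfl

lemma lintegral_gaussKernel (hε : 0 < ε) :
    ∫⁻ t, ENNReal.ofReal (gaussKernel ε t) = ENNReal.ofReal (2 * Real.pi) := by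
  have hexp : ∀ t, gaussKernel ε t = √(Real.pi / ε) * Real.exp (-(1 / (4 * ε)) * t ^ 2) :=
    fun t => by rw [gaussKernel]; ring_nf
  simp_rw [hexp]
  rw [← ofReal_integral_eq_lintegral_ofReal
    ((integrable_exp_neg_mul_sq (by positivity)).const_mul _) (.of_forall fun t => by positivity),
    integral_const_mul, integral_gaussian, ← Real.sqrt_mul (by positivity),
    show Real.pi / ε * (Real.pi / (1 / (4 * ε))) = (2 * Real.pi) ^ 2 by field_simp; norm_num,
    Real.sqrt_sq (by positivity)]

lemma lintegral_gaussKernel_sub_mul (hε : 0 < ε) {r : ℝ} (hr : r ≠ 0) (t : ℝ) :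
    ∫⁻ a, ENNReal.ofReal (gaussKernel ε (t - r * a)) = ENNReal.ofReal (2 * Real.pi / |r|) := by
  have hmap := lintegral_map (μ := (volume : Measure ℝ)) (g := fun a => r * a)
    (f := fun a => ENNReal.ofReal (gaussKernel ε (t - a))) (by fun_prop) (by fun_prop)
  rw [← hmap, Real.map_volume_mul_left hr, lintegral_smul_measure,
    lintegral_sub_left_eq_self (fun a => ENNReal.ofReal (gaussKernel ε a)) t,
    lintegral_gaussKernel hε, smul_eq_mul, ← ENNReal.ofReal_mul (abs_nonneg _), abs_inv]
  ring_nf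

end Gaussian

section PhaseIntegral

variable {X : Type*} [MeasurableSpace X] {μ : Measure X} {F : X → ℂ} {s : X → ℝ} {ε : ℝ}

/-- The Fourier integral `b ↦ ∫ F exp (i b s) dμ`, that is, the Fourier transform of the image
under `s` of the complex measure with density `F`. -/
def phaseIntegral (μ : Measure X) (F : X → ℂ) (s : X → ℝ) (b : ℝ) : ℂ :=
  ∫ y, F y * Complex.exp (Complex.I * ((b * s y : ℝ) : ℂ)) ∂μ

lemma phaseIntegral_prod_conj [SFinite μ] (F : X → ℂ) (s : X → ℝ) (b : ℝ) :
    phaseIntegral (μ.prod μ) (fun p => F p.1 * conj (F p.2)) (fun p => s p.1 - s p.2) b =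
      ((‖phaseIntegral μ F s b‖ ^ 2 : ℝ) : ℂ) := by
  have hprod := integral_prod_mul (μ := μ) (ν := μ)
    (fun y => F y * Complex.exp (Complex.I * ((b * s y : ℝ) : ℂ)))
    (fun y => conj (F y * Complex.exp (Complex.I * ((b * s y : ℝ) : ℂ))))
  rw [integral_conj, Complex.mul_conj, Complex.normSq_eq_norm_sq] at hprod
  rw [phaseIntegral, phaseIntegral, ← hprod]
  refine integral_congr_ae (.of_forall fun p => ?_)
  simp only [map_mul, ← Complex.exp_conj, Complex.conj_I, Complex.conj_ofReal]
  rw [mul_mul_mul_comm, ← Complex.exp_add]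
  push_cast
  ring_nf

lemma integrable_gaussian_mul_phase [SFinite μ] (hF : Integrable F μ) (hs : Measurable s)
    (hε : 0 < ε) :
    Integrable (fun q : ℝ × X => (Real.exp (-ε * q.1 ^ 2) : ℂ) *
      (F q.2 * Complex.exp (Complex.I * ((q.1 * s q.2 : ℝ) : ℂ)))) (volume.prod μ) := by
  have hgauss : Integrable fun b : ℝ => (Real.exp (-ε * b ^ 2) : ℂ) :=
    (integrable_exp_neg_mul_sq hε).ofReal
  simp_rw [← mul_assoc]
  refine (hgauss.mul_prod hF).mul_bdd (c := 1) ?_ (.of_forall fun q => ?_)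
  · exact Measurable.aestronglyMeasurable (by fun_prop)
  · rw [mul_comm, Complex.norm_exp_ofReal_mul_I]

lemma integrable_gaussian_mul_phaseIntegral [SFinite μ] (hF : Integrable F μ)
    (hs : Measurable s) (hε : 0 < ε) :
    Integrable fun b : ℝ => (Real.exp (-ε * b ^ 2) : ℂ) * phaseIntegral μ F s b := by
  simpa only [phaseIntegral, integral_const_mul] using
    (integrable_gaussian_mul_phase hF hs hε).integral_prod_left

lemma integral_gaussian_mul_phaseIntegral [SFinite μ] (hF : Integrable F μ) (hs : Measurable s)
    (hε : 0 < ε) :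
    ∫ b, (Real.exp (-ε * b ^ 2) : ℂ) * phaseIntegral μ F s b =
      ∫ y, F y * gaussKernel ε (s y) ∂μ := by
  simp_rw [phaseIntegral, ← integral_const_mul]
  rw [integral_integral_swap (integrable_gaussian_mul_phase hF hs hε)]
  simp_rw [mul_left_comm _ (F _), integral_const_mul, integral_exp_neg_mul_sq_mul_cexp hε]

lemma lintegral_gaussian_mul_sq_enorm_phaseIntegral_le [SFinite μ] (hF : Integrable F μ)
    (hs : Measurable s) (hε : 0 < ε) :
    ∫⁻ b, ENNReal.ofReal (Real.exp (-ε * b ^ 2)) * ‖phaseIntegral μ F s b‖ₑ ^ 2 ≤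
      ∫⁻ y, ∫⁻ y', ‖F y‖ₑ * ‖F y'‖ₑ * ENNReal.ofReal (gaussKernel ε (s y - s y')) ∂μ ∂μ := by
  set F₂ : X × X → ℂ := fun p => F p.1 * conj (F p.2) with hF₂
  set s₂ : X × X → ℝ := fun p => s p.1 - s p.2 with hs₂
  have hF₂int : Integrable F₂ (μ.prod μ) :=
    hF.mul_prod (Complex.conjLIE.toContinuousLinearEquiv.toContinuousLinearMap.integrable_comp hF)
  have hs₂meas : Measurable s₂ := by fun_prop
  have hsq : ∀ b, (Real.exp (-ε * b ^ 2) : ℂ) * phaseIntegral (μ.prod μ) F₂ s₂ b =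
      ((Real.exp (-ε * b ^ 2) * ‖phaseIntegral μ F s b‖ ^ 2 : ℝ) : ℂ) := fun b => by
    rw [phaseIntegral_prod_conj, Complex.ofReal_mul]
  have hint : Integrable fun b => Real.exp (-ε * b ^ 2) * ‖phaseIntegral μ F s b‖ ^ 2 := by
    simpa only [hsq] using! (integrable_gaussian_mul_phaseIntegral hF₂int hs₂meas hε).re
  calc ∫⁻ b, ENNReal.ofReal (Real.exp (-ε * b ^ 2)) * ‖phaseIntegral μ F s b‖ₑ ^ 2
      = ENNReal.ofReal (∫ b, Real.exp (-ε * b ^ 2) * ‖phaseIntegral μ F s b‖ ^ 2) := by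
        rw [ofReal_integral_eq_lintegral_ofReal hint (.of_forall fun b => by positivity)]
        simp_rw [ENNReal.ofReal_mul (Real.exp_nonneg _), ENNReal.ofReal_pow (norm_nonneg _),
          ofReal_norm]
    _ = ENNReal.ofReal (∫ p, F₂ p * gaussKernel ε (s₂ p) ∂(μ.prod μ)).re := by
        rw [← integral_gaussian_mul_phaseIntegral hF₂int hs₂meas hε]
        simp_rw [hsq, integral_complex_ofReal, Complex.ofReal_re]
    _ ≤ ‖∫ p, F₂ p * gaussKernel ε (s₂ p) ∂(μ.prod μ)‖ₑ := by
        rw [← ofReal_norm]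
        exact ENNReal.ofReal_le_ofReal (Complex.re_le_norm _)
    _ ≤ ∫⁻ p, ‖F₂ p * gaussKernel ε (s₂ p)‖ₑ ∂(μ.prod μ) := enorm_integral_le_lintegral_enorm _
    _ = ∫⁻ p, ‖F p.1‖ₑ * ‖F p.2‖ₑ * ENNReal.ofReal (gaussKernel ε (s p.1 - s p.2))
          ∂(μ.prod μ) := by
        refine lintegral_congr fun p => ?_
        rw [hF₂, hs₂, enorm_mul, enorm_mul, RCLike.enorm_conj, ← ofReal_norm (Complex.ofReal _),
          Complex.norm_real, Real.norm_of_nonneg (gaussKernel_nonneg _ _)]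
    _ = _ := by
        have hFenorm := hF.aestronglyMeasurable.enorm
        exact lintegral_prod _ (((hFenorm.comp_fst).mul hFenorm.comp_snd).mul
          ((measurable_gaussKernel ε).comp hs₂meas).ennreal_ofReal.aemeasurable)

end PhaseIntegral

/-! ### The slice of the Wigner function -/

section Slice

lemma two_mul_mul_le_sq_add_sq (x y : ℝ≥0∞) : 2 * (x * y) ≤ x ^ 2 + y ^ 2 := by
  induction x with
  | top => simp
  | coe x =>
    induction y with
    | top => simp
    | coe y =>
      rw [← mul_assoc]
      exact_mod_cast two_mul_le_add_sq x y

-- By AM-GM the four factors are regrouped as `(c + y, c - y')` and `(c - y, c + y')`; each pair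
-- gives the same integral, and is made of independent variables.
lemma lintegral_lintegral_reflect_le {V : Type*} [AddCommGroup V] [MeasurableSpace V]
    [MeasurableAdd₂ V] [MeasurableNeg V] {μ : Measure V} [SFinite μ] [μ.IsAddLeftInvariant]
    [μ.IsNegInvariant] {g k : V → ℝ≥0∞} (hg : Measurable g) (hk : Measurable k)
    (hk_neg : ∀ v, k (-v) = k v) (c : V) :
    ∫⁻ y, ∫⁻ y', (g (c + y) * g (c - y)) * (g (c + y') * g (c - y')) * k (y - y') ∂μ ∂μ ≤
      ∫⁻ x, ∫⁻ z, g x ^ 2 * g z ^ 2 * k (x + z - (c + c)) ∂μ ∂μ := by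
  have : MeasurableSub₂ V := ⟨by simpa only [sub_eq_add_neg] using by fun_prop⟩
  have hpair : ∫⁻ y, ∫⁻ y', g (c + y) ^ 2 * g (c - y') ^ 2 * k (y - y') ∂μ ∂μ =
      ∫⁻ x, ∫⁻ z, g x ^ 2 * g z ^ 2 * k (x + z - (c + c)) ∂μ ∂μ := by
    rw [← lintegral_add_left_eq_self (fun x => ∫⁻ z, g x ^ 2 * g z ^ 2 * k _ ∂μ) c]
    refine lintegral_congr fun y => ?_
    rw [← lintegral_sub_left_eq_self (fun z => g (c + y) ^ 2 * g z ^ 2 * k _) c]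
    refine lintegral_congr fun y' => ?_
    rw [show c + y + (c - y') - (c + c) = y - y' by abel]
  have hpair_swap : ∫⁻ y, ∫⁻ y', g (c - y) ^ 2 * g (c + y') ^ 2 * k (y - y') ∂μ ∂μ =
      ∫⁻ y, ∫⁻ y', g (c + y) ^ 2 * g (c - y') ^ 2 * k (y - y') ∂μ ∂μ := by
    rw [lintegral_lintegral_swap (by fun_prop)]
    refine lintegral_congr fun y => lintegral_congr fun y' => ?_
    rw [mul_comm (g (c - y') ^ 2), ← hk_neg, neg_sub]
  rw [← ENNReal.mul_le_mul_iff_right two_ne_zero ENNReal.ofNat_ne_top]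
  calc _ = ∫⁻ y, ∫⁻ y', 2 * ((g (c + y) * g (c - y')) * (g (c - y) * g (c + y'))) *
          k (y - y') ∂μ ∂μ := by
        simp_rw [← lintegral_const_mul' _ _ ENNReal.ofNat_ne_top]
        refine lintegral_congr fun y => lintegral_congr fun y' => ?_
        ring
    _ ≤ ∫⁻ y, ∫⁻ y', (g (c + y) ^ 2 * g (c - y') ^ 2 * k (y - y') +
          g (c - y) ^ 2 * g (c + y') ^ 2 * k (y - y')) ∂μ ∂μ := by
        gcongr with y y'
        rw [← add_mul, ← mul_pow, ← mul_pow]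
        gcongr
        exact two_mul_mul_le_sq_add_sq _ _
    _ = _ := by
        simp_rw [fun y => lintegral_add_left (μ := μ)
          (f := fun y' => g (c + y) ^ 2 * g (c - y') ^ 2 * k (y - y')) (by fun_prop)
          (fun y' => g (c - y) ^ 2 * g (c + y') ^ 2 * k (y - y'))]
        rw [lintegral_add_left (by fun_prop), hpair_swap, hpair, two_mul]

lemma lintegral_le_of_forall_gaussian_mul_le {X : Type*} [MeasurableSpace X] {μ : Measure X}
    {b : X → ℝ} (hb : Measurable b) {h : X → ℝ≥0∞} (hh : Measurable h) {C : ℝ≥0∞}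
    (hC : ∀ ε > 0, ∫⁻ x, ENNReal.ofReal (Real.exp (-ε * b x ^ 2)) * h x ∂μ ≤ C) :
    ∫⁻ x, h x ∂μ ≤ C := by
  let ε : ℕ → ℝ := fun n => 1 / ((n : ℝ) + 1)
  let G : ℕ → X → ℝ≥0∞ := fun n x => ENNReal.ofReal (Real.exp (-ε n * b x ^ 2)) * h x
  have hG : ∀ x, Filter.Tendsto (G · x) Filter.atTop (nhds (h x)) := fun x => by
    have hcont : Continuous fun t : ℝ => ENNReal.ofReal (Real.exp (-t * b x ^ 2)) :=
      ENNReal.continuous_ofReal.comp (by fun_prop)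
    have hone := (hcont.tendsto 0).comp tendsto_one_div_add_atTop_nhds_zero_nat
    simpa [Function.comp_def, G, ε] using ENNReal.Tendsto.mul_const (b := h x) hone (by simp)
  calc ∫⁻ x, h x ∂μ = ∫⁻ x, Filter.liminf (G · x) Filter.atTop ∂μ :=
        lintegral_congr fun x => (hG x).liminf_eq.symm
    _ ≤ Filter.liminf (fun n => ∫⁻ x, G n x ∂μ) Filter.atTop :=
        lintegral_liminf_le fun n => by fun_prop
    _ ≤ Filter.liminf (fun _ : ℕ => C) Filter.atTop :=
        Filter.liminf_le_liminf (.of_forall fun n => hC (ε n) (by positivity))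
    _ = C := Filter.liminf_const _

/-- The phase space point `α (1, …, 1)` with `α = p.1 + i p.2`. -/
def diag (κ : Type) (p : ℝ × ℝ) : κ → ℂ := fun _ => ⟨p.1, p.2⟩

lemma measurable_diag (κ : Type) : Measurable (diag κ) :=
  measurable_pi_lambda _ fun _ => Complex.measurableEquivRealProd.symm.measurable

variable {κ : Type} [Fintype κ] {f : Config κ → ℂ}

lemma measurable_wigner {X : Type*} [MeasurableSpace X] {α : X → κ → ℂ} (hα : Measurable α)
    (hf : Measurable f) : Measurable fun q => wigner (α q) f :=
  ((measurable_wignerKernel hα hf hf).stronglyMeasurable.integral_prod_right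
    (f := fun q y => wignerKernel (α q) f f y)).measurable

lemma wigner_diag_eq_phaseIntegral (p : ℝ × ℝ) (f : Config κ → ℂ) :
    wigner (diag κ p) f = phaseIntegral volume
      (fun y => conj (f ((fun _ => √2 * p.1) + y)) * f ((fun _ => √2 * p.1) - y))
      (fun y => 2 * √2 * ∑ m, y m) p.2 := by
  simp only [wigner, wignerKernel, wignerPhase, phaseIntegral, diag, ← Finset.mul_sum,
    mul_left_comm]
  rfl

lemma lintegral_gaussian_mul_sq_enorm_wigner_diag_le (hf : Measurable f)
    (hf2 : MemLp f 2 volume) {ε : ℝ} (hε : 0 < ε) (a : ℝ) :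
    ∫⁻ b : ℝ, ENNReal.ofReal (Real.exp (-ε * b ^ 2)) * ‖wigner (diag κ (a, b)) f‖ₑ ^ 2 ≤
      ∫⁻ x, ∫⁻ z, ‖f x‖ₑ ^ 2 * ‖f z‖ₑ ^ 2 * ENNReal.ofReal
        (gaussKernel ε (2 * √2 * ∑ m, (x m + z m) - 8 * Fintype.card κ * a)) := by
  set c : Config κ := fun _ => √2 * a
  have hint : Integrable fun y => conj (f (c + y)) * f (c - y) :=
    MemLp.integrable_mul (p := 2) (q := 2)
      (hf2.comp_measurePreserving (measurePreserving_add_left volume c)).star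
      (hf2.comp_measurePreserving (Measure.measurePreserving_sub_left volume c))
  have hsub : ∀ y y' : Config κ,
      2 * √2 * ∑ m, y m - 2 * √2 * ∑ m, y' m = 2 * √2 * ∑ m, (y - y') m := fun y y' => by
    simp only [Pi.sub_apply, Finset.sum_sub_distrib, mul_sub]
  have hcentre : ∀ x z : Config κ, 2 * √2 * ∑ m, (x + z - (c + c)) m =
      2 * √2 * ∑ m, (x m + z m) - 8 * Fintype.card κ * a := fun x z => by
    simp only [c, Pi.sub_apply, Pi.add_apply, Finset.sum_sub_distrib, Finset.sum_const,
      Finset.card_univ, nsmul_eq_mul]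
    linear_combination (-4 * Fintype.card κ * a) * Real.mul_self_sqrt (zero_le_two (α := ℝ))
  have hreflect := lintegral_lintegral_reflect_le (μ := volume) (g := fun x => ‖f x‖ₑ)
    (k := fun v : Config κ => ENNReal.ofReal (gaussKernel ε (2 * √2 * ∑ m, v m)))
    (by fun_prop) (by fun_prop) (fun v => by simp [gaussKernel_neg]) c
  simp only [hcentre] at hreflect
  refine le_trans ?_ hreflect
  simp only [wigner_diag_eq_phaseIntegral]
  refine (lintegral_gaussian_mul_sq_enorm_phaseIntegral_le hint (by fun_prop) hε).trans_eq ?_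
  simp only [enorm_mul, RCLike.enorm_conj, hsub]

lemma lintegral_sq_enorm_wigner_diag_le [Nonempty κ] (hf : Measurable f)
    (hf2 : MemLp f 2 volume) :
    ∫⁻ p, ‖wigner (diag κ p) f‖ₑ ^ 2 ≤
      ENNReal.ofReal (Real.pi / (4 * Fintype.card κ)) * (∫⁻ y, ‖f y‖ₑ ^ 2) ^ 2 := by
  have hmeas := measurable_wigner (measurable_diag κ) hf
  have hpos : (0 : ℝ) < 8 * Fintype.card κ :=
    mul_pos (by norm_num) (Nat.cast_pos.2 Fintype.card_pos)
  refine lintegral_le_of_forall_gaussian_mul_le measurable_snd (by fun_prop) fun ε hε => ?_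
  rw [Measure.volume_eq_prod, lintegral_prod _ (by fun_prop)]
  calc _ ≤ ∫⁻ a : ℝ, ∫⁻ x, ∫⁻ z, ‖f x‖ₑ ^ 2 * ‖f z‖ₑ ^ 2 * ENNReal.ofReal
          (gaussKernel ε (2 * √2 * ∑ m, (x m + z m) - 8 * Fintype.card κ * a)) :=
        lintegral_mono fun a => lintegral_gaussian_mul_sq_enorm_wigner_diag_le hf hf2 hε a
    _ = ∫⁻ x, ∫⁻ z, ∫⁻ a : ℝ, ‖f x‖ₑ ^ 2 * ‖f z‖ₑ ^ 2 * ENNReal.ofReal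
          (gaussKernel ε (2 * √2 * ∑ m, (x m + z m) - 8 * Fintype.card κ * a)) := by
        rw [lintegral_lintegral_swap (by fun_prop)]
        refine lintegral_congr fun x => ?_
        rw [lintegral_lintegral_swap (by fun_prop)]
    _ = ∫⁻ x, ∫⁻ z, ‖f x‖ₑ ^ 2 * ‖f z‖ₑ ^ 2 *
          ENNReal.ofReal (Real.pi / (4 * Fintype.card κ)) := by
        refine lintegral_congr fun x => lintegral_congr fun z => ?_
        rw [lintegral_const_mul _ (by fun_prop), lintegral_gaussKernel_sub_mul hε hpos.ne',
          abs_of_pos hpos]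
        congr 2
        field_simp
        norm_num
    _ = _ := by
        simp_rw [mul_assoc]
        rw [lintegral_lintegral_mul (f := fun x => ‖f x‖ₑ ^ 2)
          (g := fun z => ‖f z‖ₑ ^ 2 * ENNReal.ofReal (Real.pi / (4 * Fintype.card κ)))
          (by fun_prop) (by fun_prop), lintegral_mul_const _ (by fun_prop)]
        ring

end Slice

/-! ### Product vectors -/

lemma hasSum_prod_mul {𝕜 κ κ' : Type*} [RCLike 𝕜] {f : κ → 𝕜} {g : κ' → 𝕜} {a b : 𝕜}
    (hf : HasSum f a) (hg : HasSum g b) : HasSum (fun p : κ × κ' => f p.1 * g p.2) (a * b) :=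
  hf.mul hg (summable_mul_of_summable_norm hf.summable.norm hg.summable.norm)

section ProductIntegral

variable {X Y E : Type*} [MeasurableSpace X] [MeasurableSpace Y] {μ : Measure X} {ν : Measure Y}
  [NormedAddCommGroup E] [NormedSpace ℝ E] [CompleteSpace E]
  {f : X × Y → E}

lemma ae_eq_zero_of_forall_setIntegral_prod_eq_zero (hf : Integrable f (μ.prod ν))
    (hzero : ∀ s t, MeasurableSet s → MeasurableSet t → ∫ z in s ×ˢ t, f z ∂μ.prod ν = 0) :
    f =ᵐ[μ.prod ν] 0 := by
  refine hf.ae_eq_of_withDensityᵥ_eq (integrable_zero _ _ _) ?_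
  rw [withDensityᵥ_zero]
  refine VectorMeasure.ext_of_generateFrom _ ?_ generateFrom_prod.symm isPiSystem_prod ?_
  · rintro _ ⟨s, hs, t, ht, rfl⟩
    rw [withDensityᵥ_apply hf (hs.prod ht)]
    exact hzero s t hs ht
  · rw [withDensityᵥ_apply hf .univ, ← Set.univ_prod_univ]
    exact hzero _ _ .univ .univ

lemma ae_eq_zero_of_forall_setIntegral_finite_prod_eq_zero [SigmaFinite μ] [SigmaFinite ν]
    (hf : ∀ s t, MeasurableSet s → MeasurableSet t → μ s < ∞ → ν t < ∞ →
      IntegrableOn f (s ×ˢ t) (μ.prod ν))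
    (hzero : ∀ s t, MeasurableSet s → MeasurableSet t → μ s < ∞ → ν t < ∞ →
      ∫ z in s ×ˢ t, f z ∂μ.prod ν = 0) :
    f =ᵐ[μ.prod ν] 0 := by
  have hcover : ⋃ i : ℕ × ℕ, spanningSets μ i.1 ×ˢ spanningSets ν i.2 = Set.univ := by
    rw [Set.iUnion_prod, iUnion_spanningSets, iUnion_spanningSets, Set.univ_prod_univ]
  rw [← Measure.restrict_univ (μ := μ.prod ν), ← hcover]
  refine (ae_restrict_iUnion_iff _ _).2 fun i => ?_
  have hboxX := measurableSet_spanningSets μ i.1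
  have hboxY := measurableSet_spanningSets ν i.2
  have hμ := measure_spanningSets_lt_top μ i.1
  have hν := measure_spanningSets_lt_top ν i.2
  rw [← Measure.prod_restrict]
  refine ae_eq_zero_of_forall_setIntegral_prod_eq_zero ?_ fun s t hs ht => ?_
  · rw [Measure.prod_restrict]
    exact hf _ _ hboxX hboxY hμ hν
  · rw [Measure.prod_restrict, Measure.restrict_restrict (hs.prod ht), Set.prod_inter_prod]
    exact hzero _ _ (hs.inter hboxX) (ht.inter hboxY)
      ((measure_mono Set.inter_subset_right).trans_lt hμ)
      ((measure_mono Set.inter_subset_right).trans_lt hν)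

end ProductIntegral

section Product

variable {ι : Type} {A : Finset ι} [DecidableEq ι]

variable (A) in
/-- The splitting of a configuration into the positions of the modes in `A` and in `Ā`. -/
def splitEquiv : Config ι ≃ᵐ Config {m // m ∈ A} × Config {m // m ∉ A} :=
  MeasurableEquiv.piEquivPiSubtypeProd (fun _ => ℝ) (· ∈ A)

variable [Fintype ι]

lemma measurePreserving_splitEquiv : MeasurePreserving (splitEquiv A) volume volume := by
  convert! volume_preserving_piEquivPiSubtypeProd (fun _ : ι => ℝ) (· ∈ A)

lemma prodVec_coeFn (u : Space {m // m ∈ A}) (v : Space {m // m ∉ A}) :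
    (prodVec A u v : Config ι → ℂ) =ᵐ[volume]
      fun x => u (splitEquiv A x).1 * v (splitEquiv A x).2 :=
  MemLp.coeFn_toLp (memLp_prodFun A u v)

lemma prodVec_coeFn_of_ae_eq {u : Space {m // m ∈ A}} {v : Space {m // m ∉ A}}
    {f : Config {m // m ∈ A} → ℂ} {g : Config {m // m ∉ A} → ℂ} (hu : u =ᵐ[volume] f)
    (hv : v =ᵐ[volume] g) :
    (prodVec A u v : Config ι → ℂ) =ᵐ[volume]
      fun x => f (splitEquiv A x).1 * g (splitEquiv A x).2 := by
  have hsplit := (measurePreserving_splitEquiv (A := A)).quasiMeasurePreserving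
  filter_upwards [prodVec_coeFn u v,
    hsplit.ae (Measure.quasiMeasurePreserving_fst.ae hu),
    hsplit.ae (Measure.quasiMeasurePreserving_snd.ae hv)] with x huv hu hv
  rw [huv, hu, hv]

lemma integral_splitEquiv_mul (g : Config {m // m ∈ A} → ℂ) (h : Config {m // m ∉ A} → ℂ) :
    ∫ x : Config ι, g (splitEquiv A x).1 * h (splitEquiv A x).2 = (∫ y, g y) * ∫ z, h z := by
  rw [measurePreserving_splitEquiv.integral_comp (splitEquiv A).measurableEmbedding
    (fun p => g p.1 * h p.2), Measure.volume_eq_prod, integral_prod_mul]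

lemma inner_prodVec (u u' : Space {m // m ∈ A}) (v v' : Space {m // m ∉ A}) :
    ⟪prodVec A u v, prodVec A u' v'⟫_ℂ = ⟪u, u'⟫_ℂ * ⟪v, v'⟫_ℂ := by
  rw [L2.inner_def, L2.inner_def, L2.inner_def, ← integral_splitEquiv_mul]
  refine integral_congr_ae ?_
  filter_upwards [prodVec_coeFn u v, prodVec_coeFn u' v'] with x huv huv'
  simp only [huv, huv', RCLike.inner_apply, map_mul]
  ring

lemma norm_prodVec (u : Space {m // m ∈ A}) (v : Space {m // m ∉ A}) :
    ‖prodVec A u v‖ = ‖u‖ * ‖v‖ := by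
  have hinner := inner_prodVec u u v v
  simp only [inner_self_eq_norm_sq_to_K] at hinner
  refine (pow_left_inj₀ (norm_nonneg _) (by positivity) two_ne_zero).1 ?_
  rw [mul_pow]
  exact_mod_cast hinner

lemma prodVec_smul (c : ℂ) (u : Space {m // m ∈ A}) (v : Space {m // m ∉ A}) :
    prodVec A (c • u) v = c • prodVec A u v := by
  refine Lp.ext ?_
  filter_upwards [prodVec_coeFn_of_ae_eq (Lp.coeFn_smul c u) (.refl _ v), prodVec_coeFn u v,
    Lp.coeFn_smul c (prodVec A u v)] with x hcu hu hc
  rw [hcu, hc, Pi.smul_apply, Pi.smul_apply, hu, smul_mul_assoc]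

lemma wignerPhase_eq_mul (α : ι → ℂ) (y : Config ι) :
    wignerPhase α y = wignerPhase (fun m : {m // m ∈ A} => α m) (splitEquiv A y).1 *
      wignerPhase (fun m : {m // m ∉ A} => α m) (splitEquiv A y).2 := by
  simp only [wignerPhase, ← Complex.exp_add, ← mul_add, ← Complex.ofReal_add]
  rw [← Fintype.sum_subtype_add_sum_subtype (· ∈ A) fun m => (α m).im * y m]
  congr!

lemma wigner_prodVec (α : ι → ℂ) (u : Space {m // m ∈ A}) (v : Space {m // m ∉ A}) :
    wigner α (prodVec A u v) = wigner (fun m : {m // m ∈ A} => α m) u *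
      wigner (fun m : {m // m ∉ A} => α m) v := by
  rw [wigner_congr α (prodVec_coeFn u v), wigner, wigner, wigner, ← integral_splitEquiv_mul]
  refine integral_congr_ae (.of_forall fun y => ?_)
  have hadd : splitEquiv A (displacementShift α + y) =
    (displacementShift (fun m : {m // m ∈ A} => α m) + (splitEquiv A y).1,
     displacementShift (fun m : {m // m ∉ A} => α m) + (splitEquiv A y).2) := rfl
  have hsub : splitEquiv A (displacementShift α - y) =
    (displacementShift (fun m : {m // m ∈ A} => α m) - (splitEquiv A y).1,
     displacementShift (fun m : {m // m ∉ A} => α m) - (splitEquiv A y).2) := rfl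
  simp only [wignerKernel, wignerPhase_eq_mul (A := A), hadd, hsub, map_mul]
  ring

lemma setIntegral_preimage_splitEquiv_eq_inner {s : Set (Config {m // m ∈ A})}
    {t : Set (Config {m // m ∉ A})} (hs : MeasurableSet s) (ht : MeasurableSet t)
    (hμs : volume s ≠ ∞) (hμt : volume t ≠ ∞) (f : Space ι) :
    ∫ x in splitEquiv A ⁻¹' (s ×ˢ t), f x =
      ⟪prodVec A (indicatorConstLp 2 hs hμs 1) (indicatorConstLp 2 ht hμt 1), f⟫_ℂ := by
  rw [L2.inner_def, ← integral_indicator ((splitEquiv A).measurable (hs.prod ht))]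
  refine integral_congr_ae ?_
  filter_upwards [prodVec_coeFn_of_ae_eq (indicatorConstLp_coeFn (hs := hs) (hμs := hμs))
    (indicatorConstLp_coeFn (hs := ht) (hμs := hμt))] with x hx
  rw [hx]
  by_cases hxs : (splitEquiv A x).1 ∈ s <;> by_cases hxt : (splitEquiv A x).2 ∈ t <;>
    simp [Set.indicator, hxs, hxt]

lemma eq_zero_of_forall_inner_prodVec_eq_zero {f : Space ι}
    (hf : ∀ u v, ⟪prodVec A u v, f⟫_ℂ = 0) : f = 0 := by
  have hsplit := (measurePreserving_splitEquiv (A := A)).symm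
  have hfLp : MemLp (f ∘ (splitEquiv A).symm) 2 volume :=
    (Lp.memLp f).comp_measurePreserving hsplit
  have hzero : f ∘ (splitEquiv A).symm =ᵐ[volume] 0 := by
    rw [Measure.volume_eq_prod] at hfLp ⊢
    refine ae_eq_zero_of_forall_setIntegral_finite_prod_eq_zero (fun s t _ _ hμs hμt => ?_)
      fun s t hs ht hμs hμt => ?_
    · have : IsFiniteMeasure ((volume.prod volume).restrict (s ×ˢ t)) :=
        ⟨by simpa [Measure.prod_prod] using ENNReal.mul_lt_top hμs hμt⟩
      exact (hfLp.restrict _).integrable one_le_two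
    · rw [← hf (indicatorConstLp 2 hs hμs.ne 1) (indicatorConstLp 2 ht hμt.ne 1),
        ← setIntegral_preimage_splitEquiv_eq_inner, ← Measure.volume_eq_prod,
        ← measurePreserving_splitEquiv.setIntegral_preimage_emb
          (splitEquiv A).measurableEmbedding]
      simp only [Function.comp_apply, MeasurableEquiv.symm_apply_apply]
  refine Lp.ext (.trans ?_ (Lp.coeFn_zero _ _ _).symm)
  filter_upwards [measurePreserving_splitEquiv.quasiMeasurePreserving.ae hzero] with x hx
  simpa using hx

lemma op_ext_prodVec {S T : Op ι}
    (hST : ∀ u v u' v', ⟪prodVec A u v, S (prodVec A u' v')⟫_ℂ =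
      ⟪prodVec A u v, T (prodVec A u' v')⟫_ℂ) : S = T := by
  have hprod : ∀ u v, S (prodVec A u v) = T (prodVec A u v) := fun u' v' =>
    sub_eq_zero.1 (eq_zero_of_forall_inner_prodVec_eq_zero (A := A) fun u v => by
      rw [inner_sub_right, hST, sub_self])
  refine ContinuousLinearMap.ext fun y => ext_inner_left ℂ fun x => ?_
  rw [← ContinuousLinearMap.adjoint_inner_left, ← ContinuousLinearMap.adjoint_inner_left]
  congr 1
  refine sub_eq_zero.1 (eq_zero_of_forall_inner_prodVec_eq_zero (A := A) fun u v => ?_)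
  rw [inner_sub_right, ContinuousLinearMap.adjoint_inner_right,
    ContinuousLinearMap.adjoint_inner_right, hprod, sub_self]

lemma hasSum_sq_norm_prodVec {κ κ' : Type*} {u : κ → Space {m // m ∈ A}}
    {v : κ' → Space {m // m ∉ A}} {a b : ℝ} (hu : HasSum (fun i => ‖u i‖ ^ 2) a)
    (hv : HasSum (fun j => ‖v j‖ ^ 2) b) :
    HasSum (fun p : κ × κ' => ‖prodVec A (u p.1) (v p.2)‖ ^ 2) (a * b) := by
  simpa only [norm_prodVec, mul_pow] using hasSum_prod_mul hu hv

lemma IsTensor.isEnsemble {κ κ' : Type*} {σA : Op {m // m ∈ A}} {σB : Op {m // m ∉ A}}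
    {σ : Op ι} (hσ : IsTensor A σA σB σ) {u : κ → Space {m // m ∈ A}}
    {v : κ' → Space {m // m ∉ A}} (hu : IsEnsemble σA u) (hv : IsEnsemble σB v) :
    IsEnsemble σ fun p : κ × κ' => prodVec A (u p.1) (v p.2) := by
  have hsum := (hasSum_sq_norm_prodVec (A := A) hu.1.hasSum hv.1.hasSum).summable
  obtain ⟨T, hT⟩ : ∃ T, IsEnsemble T fun p : κ × κ' => prodVec A (u p.1) (v p.2) :=
    ⟨_, .of_summable hsum⟩
  suffices hσT : σ = T from hσT ▸ hT
  refine op_ext_prodVec (A := A) fun x y x' y' => ?_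
  have hx := hu.hasSum_inner x x'
  have hy := hv.hasSum_inner y y'
  rw [hσ, inner_prodVec]
  refine (hasSum_prod_mul hx hy).unique ?_
  simpa only [inner_prodVec, mul_mul_mul_comm] using
    hT.hasSum_inner (prodVec A x y) (prodVec A x' y')

lemma IsBiseparableMixture.exists_isEnsemble {ρ : Op ι} (hρ : IsBiseparableMixture ρ) :
    ∃ (κ : Type) (_ : Countable κ) (A : κ → Finset ι) (u : ∀ i, Space {m // m ∈ A i})
      (v : ∀ i, Space {m // m ∉ A i}), (∀ i, (A i).Nonempty ∧ (A i)ᶜ.Nonempty) ∧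
      IsEnsemble ρ fun i => prodVec (A i) (u i) (v i) := by
  obtain ⟨p, σ, hp, hp1, hσ, hsum⟩ := hρ
  choose A hA hAc σA σB hσA hσB hσAB using hσ
  choose κ hκ u hu using fun k => (hσA k).exists_isEnsemble
  choose κ' hκ' v hv using fun k => (hσB k).exists_isEnsemble
  have hprod := fun k => ((hσAB k).isEnsemble (hu k) (hv k)).smul (hp k)
  have hmass : ∀ k, ∑' q : κ k × κ' k, ‖(√(p k) : ℂ) • prodVec (A k) (u k q.1) (v k q.2)‖ ^ 2 =
      p k := fun k => by
    have hone := hasSum_sq_norm_prodVec (A := A k) ((hu k).hasSum_sq_norm (hσA k).2)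
      ((hv k).hasSum_sq_norm (hσB k).2)
    simpa only [norm_smul, Complex.norm_real, Real.norm_of_nonneg (Real.sqrt_nonneg _), mul_pow,
      Real.sq_sqrt (hp k), mul_one] using (hone.mul_left (p k)).tsum_eq
  refine ⟨Σ k, κ k × κ' k, inferInstance, fun i => A i.1,
    fun i => (√(p i.1) : ℂ) • u i.1 i.2.1, fun i => v i.1 i.2.2, fun i => ⟨hA i.1, hAc i.1⟩, ?_⟩
  simpa only [prodVec_smul] using
    IsEnsemble.sigma hprod hsum (by simpa only [hmass] using hp1.summable)

end Product

/-! ### Biseparable mixtures -/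

section Biseparable

lemma sq_lintegral_mul_le {X : Type*} [MeasurableSpace X] {μ : Measure X} {f g : X → ℝ≥0∞}
    (hf : AEMeasurable f μ) (hg : AEMeasurable g μ) :
    (∫⁻ x, f x * g x ∂μ) ^ 2 ≤ (∫⁻ x, f x ^ 2 ∂μ) * ∫⁻ x, g x ^ 2 ∂μ := by
  have hholder := ENNReal.lintegral_mul_le_Lp_mul_Lq μ Real.HolderConjugate.two_two hf hg
  simp only [Pi.mul_apply, ENNReal.rpow_two, one_div] at hholder
  have hroot : ∀ x : ℝ≥0∞, (x ^ (2⁻¹ : ℝ)) ^ 2 = x := fun x => by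
    rw [← ENNReal.rpow_two, ENNReal.rpow_inv_rpow two_ne_zero]
  calc _ ≤ _ := pow_le_pow_left' hholder 2
    _ = _ := by rw [mul_pow, hroot, hroot]

lemma lintegral_sq_enorm_eq {κ : Type} [Fintype κ] (u : Space κ) :
    ∫⁻ y, ‖u y‖ₑ ^ 2 = ‖u‖ₑ ^ 2 := by
  rw [Lp.enorm_def]
  simpa using (eLpNorm_nnreal_pow_eq_lintegral (μ := (volume : Measure (Config κ)))
    (f := (u : Config κ → ℂ)) (p := 2) two_ne_zero).symm

lemma measurable_wigner_diag {κ : Type} [Fintype κ] (u : Space κ) :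
    Measurable fun p => wigner (diag κ p) u :=
  measurable_wigner (measurable_diag κ) (Lp.stronglyMeasurable u).measurable

lemma lintegral_sq_enorm_wigner_diag_space_le {κ : Type} [Fintype κ] [Nonempty κ]
    (u : Space κ) :
    ∫⁻ p, ‖wigner (diag κ p) u‖ₑ ^ 2 ≤
      ENNReal.ofReal (Real.pi / (4 * Fintype.card κ)) * (‖u‖ₑ ^ 2) ^ 2 := by
  rw [← lintegral_sq_enorm_eq]
  exact lintegral_sq_enorm_wigner_diag_le (Lp.stronglyMeasurable u).measurable (Lp.memLp u)

/-- The constant `π / (4 √(M - 1))` bounding the slice integral of biseparable states of `M`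
modes. -/
def sliceBound (M : ℕ) : ℝ := Real.pi / (4 * √((M : ℝ) - 1))

lemma pi_div_mul_pi_div_le_sq_sliceBound {k l : ℕ} (hk : 1 ≤ k) (hl : 1 ≤ l) :
    Real.pi / (4 * k) * (Real.pi / (4 * l)) ≤ sliceBound (k + l) ^ 2 := by
  have hk' : (1 : ℝ) ≤ k := by exact_mod_cast hk
  have hl' : (1 : ℝ) ≤ l := by exact_mod_cast hl
  rw [sliceBound, div_mul_div_comm, div_pow, mul_pow, ← pow_two,
    Real.sq_sqrt (by push_cast; linarith)]
  refine div_le_div_of_nonneg_left (by positivity) ?_ ?_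
  · push_cast
    linarith
  · push_cast
    nlinarith

variable {ι : Type} [Fintype ι] [DecidableEq ι]

lemma sq_lintegral_enorm_wigner_prodVec_le {A : Finset ι} [Nonempty {m // m ∈ A}]
    [Nonempty {m // m ∉ A}] (u : Space {m // m ∈ A}) (v : Space {m // m ∉ A}) :
    (∫⁻ p, ‖wigner (diag ι p) (prodVec A u v)‖ₑ) ^ 2 ≤
      ENNReal.ofReal (Real.pi / (4 * Fintype.card {m // m ∈ A}) *
        (Real.pi / (4 * Fintype.card {m // m ∉ A}))) * (‖prodVec A u v‖ₑ ^ 2) ^ 2 := by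
  have hnorm : ‖prodVec A u v‖ₑ = ‖u‖ₑ * ‖v‖ₑ := by
    rw [← ofReal_norm, norm_prodVec, ENNReal.ofReal_mul (norm_nonneg _), ofReal_norm, ofReal_norm]
  have hfactor : ∀ p, ‖wigner (diag ι p) (prodVec A u v)‖ₑ =
      ‖wigner (diag {m // m ∈ A} p) u‖ₑ * ‖wigner (diag {m // m ∉ A} p) v‖ₑ := fun p => by
    rw [wigner_prodVec, enorm_mul]
    rfl
  calc _ ≤ (∫⁻ p, ‖wigner (diag {m // m ∈ A} p) u‖ₑ ^ 2) *
        ∫⁻ p, ‖wigner (diag {m // m ∉ A} p) v‖ₑ ^ 2 := by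
        simp only [hfactor]
        exact sq_lintegral_mul_le (measurable_wigner_diag u).enorm.aemeasurable
          (measurable_wigner_diag v).enorm.aemeasurable
    _ ≤ _ := mul_le_mul' (lintegral_sq_enorm_wigner_diag_space_le u)
        (lintegral_sq_enorm_wigner_diag_space_le v)
    _ = _ := by
        rw [mul_mul_mul_comm, ← ENNReal.ofReal_mul (by positivity), hnorm, ← mul_pow,
          mul_pow ‖u‖ₑ]

lemma lintegral_enorm_wigner_prodVec_le {A : Finset ι} (hA : A.Nonempty) (hAc : Aᶜ.Nonempty)
    (u : Space {m // m ∈ A}) (v : Space {m // m ∉ A}) :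
    ∫⁻ p, ‖wigner (diag ι p) (prodVec A u v)‖ₑ ≤
      ENNReal.ofReal (sliceBound (Fintype.card ι)) * ‖prodVec A u v‖ₑ ^ 2 := by
  have : Nonempty {m // m ∈ A} := hA.to_subtype
  have : Nonempty {m // m ∉ A} :=
    have ⟨m, hm⟩ := hAc
    ⟨⟨m, Finset.mem_compl.1 hm⟩⟩
  have hcard : Fintype.card ι = Fintype.card {m // m ∈ A} + Fintype.card {m // m ∉ A} := by
    rw [← Fintype.card_sum, Fintype.card_congr (Equiv.sumCompl (· ∈ A))]
  have hbound : 0 ≤ sliceBound (Fintype.card ι) := by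
    unfold sliceBound
    positivity
  refine (ENNReal.pow_right_strictMono two_ne_zero).le_iff_le.1 ?_
  refine (sq_lintegral_enorm_wigner_prodVec_le u v).trans ?_
  rw [mul_pow, ← ENNReal.ofReal_pow hbound, hcard]
  gcongr
  exact pi_div_mul_pi_div_le_sq_sliceBound Fintype.card_pos Fintype.card_pos

lemma IsBiseparableMixture.lintegral_enorm_trace_le {ρ : Op ι} (h : IsBiseparableMixture ρ)
    (hρ : trace ρ = 1) :
    ∫⁻ p, ‖trace (ρ ∘L displacedParity (diag ι p))‖ₑ ≤
      ENNReal.ofReal (sliceBound (Fintype.card ι)) := by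
  obtain ⟨κ, hκ, A, u, v, hA, hψ⟩ := h.exists_isEnsemble
  calc _ ≤ ∫⁻ p, ∑' i, ‖wigner (diag ι p) (prodVec (A i) (u i) (v i))‖ₑ :=
        lintegral_mono fun p => by
          simpa only [inner_displacedParity] using
            hψ.enorm_trace_comp_le (displacedParity (diag ι p))
    _ = ∑' i, ∫⁻ p, ‖wigner (diag ι p) (prodVec (A i) (u i) (v i))‖ₑ :=
        lintegral_tsum fun i => (measurable_wigner_diag _).enorm.aemeasurable
    _ ≤ ∑' i, ENNReal.ofReal (sliceBound (Fintype.card ι)) *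
          ‖prodVec (A i) (u i) (v i)‖ₑ ^ 2 :=
        ENNReal.tsum_le_tsum fun i => lintegral_enorm_wigner_prodVec_le (hA i).1 (hA i).2 _ _
    _ = _ := by rw [ENNReal.tsum_mul_left, hψ.tsum_sq_enorm hρ, mul_one]

end Biseparable

/-! ### Dependence of the Wigner function on the displacement -/

section Lipschitz

lemma integral_sub_integral_eq_intervalIntegral {X : Type*} [MeasurableSpace X] {μ : Measure X}
    [SFinite μ] {F F' : ℝ → X → ℂ} {a b : ℝ} (hF : ∀ x t, HasDerivAt (F · x) (F' t x) t)
    (hF' : ∀ x, Continuous (F' · x)) (ha : Integrable (F a) μ) (hb : Integrable (F b) μ)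
    (hint : Integrable (Function.uncurry F') ((volume.restrict (Set.uIoc a b)).prod μ)) :
    ∫ x, F b x ∂μ - ∫ x, F a x ∂μ = ∫ t in a..b, ∫ x, F' t x ∂μ := by
  rw [intervalIntegral_integral_swap hint, ← integral_sub hb ha]
  exact integral_congr_ae (.of_forall fun x =>
    (intervalIntegral.integral_eq_sub_of_hasDerivAt (fun t _ => hF x t)
      ((hF' x).intervalIntegrable _ _)).symm)

lemma integral_eq_zero_of_hasLineDerivAt {E : Type*} [NormedAddCommGroup E] [NormedSpace ℝ E]
    [MeasurableSpace E] [BorelSpace E] [FiniteDimensional ℝ E] {μ : Measure E}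
    [μ.IsAddHaarMeasure] {g g' : E → ℂ} {v : E} (hg : Integrable g μ) (hg' : Integrable g' μ)
    (h : ∀ x, HasLineDerivAt ℝ g (g' x) x v) : ∫ x, g' x ∂μ = 0 := by
  simpa using integral_bilinear_hasLineDerivAt_right_eq_neg_left_of_integrable
    (B := ContinuousLinearMap.mul ℝ ℂ) (f := fun _ => 1) (f' := fun _ => 0)
    (by simp) (by simpa using hg') (by simpa using hg)
    (fun x _ => (hasFDerivAt_const (1 : ℂ) x).hasLineDerivAt v) fun x _ => h x

lemma hasDerivAt_conj_mul_mul_cexp {E : Type*} [NormedAddCommGroup E] [NormedSpace ℝ E]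
    {f : E → ℂ} (hf : Differentiable ℝ f) {x y : ℝ → E} {θ : ℝ → ℝ} {e : E} {σ τ ω t : ℝ}
    (hx : HasDerivAt x (σ • e) t) (hy : HasDerivAt y (τ • e) t) (hθ : HasDerivAt θ ω t) :
    HasDerivAt (fun t => conj (f (x t)) * f (y t) * Complex.exp (Complex.I * (θ t : ℂ)))
      ((σ * (conj (fderiv ℝ f (x t) e) * f (y t)) + τ * (conj (f (x t)) * fderiv ℝ f (y t) e) +
        Complex.I * ω * (conj (f (x t)) * f (y t))) * Complex.exp (Complex.I * (θ t : ℂ))) t := by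
  have hfx : HasDerivAt (fun t => conj (f (x t))) (conj (fderiv ℝ f (x t) (σ • e))) t :=
    ((hf (x t)).hasFDerivAt.comp_hasDerivAt t hx).star
  have hfy : HasDerivAt (fun t => f (y t)) (fderiv ℝ f (y t) (τ • e)) t :=
    (hf (y t)).hasFDerivAt.comp_hasDerivAt t hy
  convert! (hfx.mul hfy).mul (hθ.ofReal_comp.const_mul Complex.I).cexp using 1
  simp only [map_smul, Complex.real_smul, map_mul, Complex.conj_ofReal, Pi.mul_apply]
  ring

variable {ι : Type} [Fintype ι]

lemma lintegral_enorm_wignerKernel_schwartz_le (f g : SchwartzMap (Config ι) ℂ) (α : ι → ℂ) :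
    ∫⁻ y, ‖wignerKernel α f g y‖ₑ ≤ eLpNorm f 2 volume * eLpNorm g 2 volume :=
  lintegral_enorm_wignerKernel_le (f.memLp 2 volume).1 (g.memLp 2 volume).1 α

lemma integrable_wignerKernel_schwartz (f g : SchwartzMap (Config ι) ℂ) (α : ι → ℂ) :
    Integrable (wignerKernel α f g) :=
  integrable_wignerKernel (f.memLp 2 volume) (g.memLp 2 volume) α

lemma norm_integral_wignerKernel_le (f g : SchwartzMap (Config ι) ℂ) (α : ι → ℂ) :
    ‖∫ y, wignerKernel α f g y‖ ≤
      (eLpNorm f 2 volume).toReal * (eLpNorm g 2 volume).toReal := by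
  rw [← toReal_enorm, ← ENNReal.toReal_mul]
  exact ENNReal.toReal_mono (ENNReal.mul_ne_top (f.memLp 2 volume).2.ne (g.memLp 2 volume).2.ne)
    ((enorm_integral_le_lintegral_enorm _).trans (lintegral_enorm_wignerKernel_schwartz_le f g α))

lemma integrable_prod_wignerKernel (f g : SchwartzMap (Config ι) ℂ) {α : ℝ → ι → ℂ}
    (hα : Continuous α) (a b : ℝ) :
    Integrable (Function.uncurry fun t y => wignerKernel (α t) f g y)
      ((volume.restrict (Set.uIoc a b)).prod volume) := by
  have hmeas : StronglyMeasurable (Function.uncurry fun t y => wignerKernel (α t) f g y) :=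
    (continuous_wignerKernel hα f.continuous g.continuous).stronglyMeasurable
  refine ⟨hmeas.aestronglyMeasurable, ?_⟩
  rw [HasFiniteIntegral, lintegral_prod _ hmeas.enorm.aemeasurable]
  calc _ ≤ ∫⁻ _ in Set.uIoc a b, eLpNorm f 2 volume * eLpNorm g 2 volume :=
        lintegral_mono fun t => lintegral_enorm_wignerKernel_schwartz_le f g (α t)
    _ < ∞ := by
        rw [setLIntegral_const]
        exact ENNReal.mul_lt_top (ENNReal.mul_lt_top (f.memLp 2 volume).2 (g.memLp 2 volume).2)
          (by simp [Set.uIoc])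

lemma continuous_wignerKernel_path (f g : SchwartzMap (Config ι) ℂ) {α : ℝ → ι → ℂ}
    (hα : Continuous α) (y : Config ι) : Continuous fun t => wignerKernel (α t) f g y :=
  (continuous_wignerKernel hα f.continuous g.continuous).along_fst

/-- The position operator of mode `m` on Schwartz functions. -/
def position (m : ι) (η : SchwartzMap (Config ι) ℂ) : SchwartzMap (Config ι) ℂ :=
  SchwartzMap.smulLeftCLM ℂ (fun x : Config ι => (x m : ℂ)) η

lemma position_apply (m : ι) (η : SchwartzMap (Config ι) ℂ) (x : Config ι) :
    position m η x = x m * η x :=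
  SchwartzMap.smulLeftCLM_apply_apply
    (Complex.ofRealCLM ∘L
      ContinuousLinearMap.proj (R := ℝ) (φ := fun _ : ι => ℝ) m).hasTemperateGrowth η x

lemma wignerKernel_position_add (m : ι) (η : SchwartzMap (Config ι) ℂ) (α : ι → ℂ) (y : Config ι) :
    wignerKernel α (position m η) η y + wignerKernel α η (position m η) y =
      2 * √2 * (α m).re * wignerKernel α η η y := by
  simp only [wignerKernel, position_apply, map_mul, Complex.conj_ofReal, Pi.add_apply,
    Pi.sub_apply, displacementShift]
  push_cast
  ring

variable [DecidableEq ι]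

/-- The partial derivative `∂ₘ` on Schwartz functions. -/
def partialDeriv (m : ι) (η : SchwartzMap (Config ι) ℂ) : SchwartzMap (Config ι) ℂ :=
  LineDeriv.lineDerivOp (Pi.single m 1 : Config ι) η

lemma partialDeriv_apply (m : ι) (η : SchwartzMap (Config ι) ℂ) (x : Config ι) :
    partialDeriv m η x = fderiv ℝ η x (Pi.single m 1) :=
  SchwartzMap.lineDerivOp_apply_eq_fderiv _ _ _

/-- The annihilation operator `aₘ = (xₘ + ∂ₘ) / √2` on Schwartz functions. -/
def annihilation (m : ι) (η : SchwartzMap (Config ι) ℂ) : SchwartzMap (Config ι) ℂ :=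
  (√2 : ℂ)⁻¹ • (position m η + partialDeriv m η)

lemma coe_annihilation (m : ι) (η : SchwartzMap (Config ι) ℂ) :
    ⇑(annihilation m η) = annihilationExpr m η := by
  ext x
  simp [annihilation, annihilationExpr, position_apply, partialDeriv_apply, inv_mul_eq_div, add_div]

lemma sqrt_two_mul_annihilation_apply (m : ι) (η : SchwartzMap (Config ι) ℂ) (x : Config ι) :
    √2 * annihilation m η x = x m * η x + partialDeriv m η x := by
  simp [annihilation, position_apply, ← mul_add]

/-- The derivative of `wignerKernel α η η y` with respect to `αₘ`, in the direction `v`. -/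
def modeDeriv (m : ι) (v : ℂ) (α : ι → ℂ) (η : SchwartzMap (Config ι) ℂ) (y : Config ι) : ℂ :=
  √2 * v.re * (wignerKernel α (partialDeriv m η) η y + wignerKernel α η (partialDeriv m η) y) +
    Complex.I * √2 * v.im * (wignerKernel α (position m η) η y - wignerKernel α η (position m η) y)

/-- The derivative of `wignerKernel α η η y` with respect to `yₘ`. -/
def coordDeriv (m : ι) (α : ι → ℂ) (η : SchwartzMap (Config ι) ℂ) (y : Config ι) : ℂ :=
  wignerKernel α (partialDeriv m η) η y - wignerKernel α η (partialDeriv m η) y +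
    Complex.I * (2 * √2 * (α m).im) * wignerKernel α η η y

lemma displacementShift_update {κ : Type} [DecidableEq κ] (α : κ → ℂ) (m : κ) (z : ℂ) :
    displacementShift (Function.update α m z) =
      displacementShift α + (√2 * (z - α m).re) • (Pi.single m 1 : Config κ) := by
  ext k
  obtain rfl | hk := eq_or_ne k m
  · simp only [displacementShift, Function.update_self, Complex.sub_re, Pi.add_apply,
      Pi.smul_apply, Pi.single_eq_same, smul_eq_mul]
    ring
  · simp [displacementShift, hk]

lemma sum_im_update_mul (α : ι → ℂ) (m : ι) (z : ℂ) (y : Config ι) :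
    ∑ k, (Function.update α m z k).im * y k = ∑ k, (α k).im * y k + (z - α m).im * y m := by
  rw [← sub_eq_iff_eq_add', ← Finset.sum_sub_distrib, Finset.sum_eq_single_of_mem m
    (Finset.mem_univ m) fun k _ hk => by simp [hk]]
  simp only [Function.update_self, Complex.sub_im]
  ring

lemma sum_im_mul_add_single (α : ι → ℂ) (m : ι) (y : Config ι) (t : ℝ) :
    ∑ k, (α k).im * (y + t • (Pi.single m 1 : Config ι)) k =
      ∑ k, (α k).im * y k + t * (α m).im := by
  simp [mul_add, Finset.sum_add_distrib, Pi.single_apply, mul_comm]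

variable (η : SchwartzMap (Config ι) ℂ) (m : ι)

lemma hasDerivAt_wignerKernel_update (α : ι → ℂ) (v : ℂ) (y : Config ι) (t : ℝ) :
    HasDerivAt (fun t : ℝ => wignerKernel (Function.update α m (α m + t * v)) η η y)
      (modeDeriv m v (Function.update α m (α m + t * v)) η y) t := by
  set c := displacementShift α
  set e : Config ι := Pi.single m 1 with he
  have hshift : ∀ t : ℝ, displacementShift (Function.update α m (α m + t * v)) =
      c + (t * (√2 * v.re)) • e := fun t => by
    rw [displacementShift_update, add_sub_cancel_left, Complex.re_ofReal_mul, mul_left_comm]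
  have hphase : ∀ t : ℝ, wignerPhase (Function.update α m (α m + t * v)) y = Complex.exp
      (Complex.I * ((2 * √2 * (∑ k, (α k).im * y k + t * (v.im * y m)) : ℝ) : ℂ)) := fun t => by
    rw [wignerPhase, sum_im_update_mul, add_sub_cancel_left, Complex.im_ofReal_mul, mul_assoc t]
  have hcentre : HasDerivAt (fun t : ℝ => c + (t * (√2 * v.re)) • e) ((√2 * v.re) • e) t := by
    simpa using (((hasDerivAt_id t).mul_const (√2 * v.re)).smul_const e).const_add c
  have hangle : HasDerivAt
      (fun t : ℝ => 2 * √2 * (∑ k, (α k).im * y k + t * (v.im * y m)))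
      (2 * √2 * (v.im * y m)) t := by
    simpa using (((hasDerivAt_id t).mul_const (v.im * y m)).const_add _).const_mul (2 * √2)
  convert hasDerivAt_conj_mul_mul_cexp η.differentiable (hcentre.add_const y)
    (hcentre.sub_const y) hangle using 1
  · ext t
    rw [wignerKernel, hshift, hphase]
  · simp only [modeDeriv, wignerKernel, hshift, hphase, partialDeriv_apply, position_apply,
      map_mul, Complex.conj_ofReal, Pi.add_apply, Pi.sub_apply, he]
    push_cast
    ring

lemma hasLineDerivAt_wignerKernel (α : ι → ℂ) (y : Config ι) :
    HasLineDerivAt ℝ (wignerKernel α η η) (coordDeriv m α η y) y (Pi.single m 1) := by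
  set c := displacementShift α
  set e : Config ι := Pi.single m 1 with he
  have hline : HasDerivAt (fun t : ℝ => y + t • e) e 0 := by
    simpa using ((hasDerivAt_id (0 : ℝ)).smul_const e).const_add y
  have hadd : HasDerivAt (fun t : ℝ => c + (y + t • e)) ((1 : ℝ) • e) 0 := by
    simpa using hline.const_add c
  have hsub : HasDerivAt (fun t : ℝ => c - (y + t • e)) ((-1 : ℝ) • e) 0 := by
    simpa using hline.const_sub c
  have hangle : HasDerivAt (fun t : ℝ => 2 * √2 * ∑ k, (α k).im * (y + t • e) k)
      (2 * √2 * (α m).im) 0 := by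
    simp only [he, sum_im_mul_add_single]
    simpa using (((hasDerivAt_id (0 : ℝ)).mul_const (α m).im).const_add _).const_mul (2 * √2)
  have h := hasDerivAt_conj_mul_mul_cexp η.differentiable hadd hsub hangle
  simp only [zero_smul, add_zero] at h
  rw [HasLineDerivAt]
  convert! h using 1
  simp only [coordDeriv, wignerKernel, partialDeriv_apply, wignerPhase]
  push_cast
  ring

lemma integrable_coordDeriv (α : ι → ℂ) : Integrable (coordDeriv m α η) :=
  ((integrable_wignerKernel_schwartz _ _ α).sub (integrable_wignerKernel_schwartz _ _ α)).add
    ((integrable_wignerKernel_schwartz _ _ α).const_mul _)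

lemma integral_coordDeriv (α : ι → ℂ) : ∫ y, coordDeriv m α η y = 0 :=
  integral_eq_zero_of_hasLineDerivAt (integrable_wignerKernel_schwartz η η α)
    (integrable_coordDeriv η m α) (hasLineDerivAt_wignerKernel η m α)

lemma sqrt_two_mul_wignerKernel_annihilation_left (α : ι → ℂ) (y : Config ι) :
    √2 * wignerKernel α (annihilation m η) η y =
      wignerKernel α (position m η) η y + wignerKernel α (partialDeriv m η) η y := by
  have h := congrArg conj (sqrt_two_mul_annihilation_apply m η (displacementShift α + y))
  simp only [map_mul, map_add, Complex.conj_ofReal] at h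
  simp only [wignerKernel, position_apply, map_mul, Complex.conj_ofReal]
  linear_combination h * η (displacementShift α - y) * wignerPhase α y

lemma sqrt_two_mul_wignerKernel_annihilation_right (α : ι → ℂ) (y : Config ι) :
    √2 * wignerKernel α η (annihilation m η) y =
      wignerKernel α η (position m η) y + wignerKernel α η (partialDeriv m η) y := by
  have h := sqrt_two_mul_annihilation_apply m η (displacementShift α - y)
  simp only [wignerKernel, position_apply]
  linear_combination conj (η (displacementShift α + y)) * h * wignerPhase α y

/- The infinitesimal form of `Π(α) aₘ = (2 αₘ - aₘ) Π(α)`: up to a total derivative, the variation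
of the kernel only involves `aₘ`, and neither `xₘ` nor `∂ₘ` separately. -/
lemma modeDeriv_eq (v : ℂ) (α : ι → ℂ) (y : Config ι) :
    modeDeriv m v α η y = 2 * v * wignerKernel α (annihilation m η) η y +
      2 * conj v * wignerKernel α η (annihilation m η) y -
      (4 * ((conj v * α m).re : ℂ) * wignerKernel α η η y +
        Complex.I * √2 * v.im * coordDeriv m α η y) := by
  have hs : (√2 : ℂ) * √2 = 2 := by
    rw [← Complex.ofReal_mul, Real.mul_self_sqrt zero_le_two, Complex.ofReal_ofNat]
  have hleft := sqrt_two_mul_wignerKernel_annihilation_left η m α y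
  have hright := sqrt_two_mul_wignerKernel_annihilation_right η m α y
  have hposition := wignerKernel_position_add m η α y
  have hre : (((conj v * α m).re : ℝ) : ℂ) = v.re * (α m).re + v.im * (α m).im := by
    simp
  have hv : v = v.re + v.im * Complex.I := (Complex.re_add_im v).symm
  have hconj : conj v = v.re - v.im * Complex.I := Complex.ext (by simp) (by simp)
  rw [hre, modeDeriv, coordDeriv]
  generalize wignerKernel α (annihilation m η) η y = wa at *
  generalize wignerKernel α η (annihilation m η) y = aw at *
  generalize wignerKernel α η η y = w at *
  linear_combination (-2 * wa) * hv - 2 * aw * hconj -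
    (v.re + v.im * Complex.I) * √2 * hleft - (v.re - v.im * Complex.I) * √2 * hright -
    √2 * v.re * hposition +
    ((v.re + v.im * Complex.I) * wa + (v.re - v.im * Complex.I) * aw -
      2 * v.re * (α m).re * w - 2 * v.im * (α m).im * w) * hs +
    2 * (√2 : ℂ) ^ 2 * v.im * (α m).im * w * Complex.I_sq

lemma integral_modeDeriv (v : ℂ) (α : ι → ℂ) :
    ∫ y, modeDeriv m v α η y = 2 * v * (∫ y, wignerKernel α (annihilation m η) η y) +
      2 * conj v * (∫ y, wignerKernel α η (annihilation m η) y) -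
      4 * ((conj v * α m).re : ℂ) * wigner α η := by
  have hleft := (integrable_wignerKernel_schwartz (annihilation m η) η α).const_mul (2 * v)
  have hright := (integrable_wignerKernel_schwartz η (annihilation m η) α).const_mul (2 * conj v)
  have hself := (integrable_wignerKernel_schwartz η η α).const_mul
    (4 * ((conj v * α m).re : ℂ))
  have htotal := (integrable_coordDeriv η m α).const_mul (Complex.I * √2 * v.im)
  simp_rw [modeDeriv_eq]
  rw [integral_sub (hleft.fun_add hright) (hself.fun_add htotal), integral_add hleft hright,
    integral_add hself htotal]
  simp only [integral_const_mul, integral_coordDeriv, mul_zero, add_zero, wigner]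

lemma norm_integral_modeDeriv_le (v : ℂ) (α : ι → ℂ) :
    ‖∫ y, modeDeriv m v α η y‖ ≤ 4 * ‖v‖ * ((eLpNorm η 2 volume).toReal *
      (eLpNorm (annihilation m η) 2 volume).toReal +
        ‖α m‖ * (eLpNorm η 2 volume).toReal ^ 2) := by
  set N := (eLpNorm η 2 volume).toReal
  set X := (eLpNorm (annihilation m η) 2 volume).toReal
  have hdot : ‖((conj v * α m).re : ℂ)‖ ≤ ‖v‖ * ‖α m‖ := by
    rw [Complex.norm_real, ← RCLike.norm_conj v, ← norm_mul]
    exact Complex.abs_re_le_norm _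
  rw [integral_modeDeriv]
  calc _ ≤ 2 * ‖v‖ * (X * N) + 2 * ‖v‖ * (N * X) + 4 * (‖v‖ * ‖α m‖) * (N * N) := by
        refine (norm_sub_le _ _).trans (add_le_add ((norm_add_le _ _).trans ?_) ?_)
        all_goals simp only [norm_mul, RCLike.norm_conj, RCLike.norm_ofNat]
        all_goals gcongr <;> exact norm_integral_wignerKernel_le _ _ _
    _ = _ := by ring

lemma wigner_update_sub_wigner (v : ℂ) (α : ι → ℂ) :
    wigner (Function.update α m (α m + v)) η - wigner α η =
      ∫ t in (0 : ℝ)..1, ∫ y, modeDeriv m v (Function.update α m (α m + t * v)) η y := by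
  have hpath : Continuous fun t : ℝ => Function.update α m (α m + t * v) := by fun_prop
  have hprod := fun f g => integrable_prod_wignerKernel f g hpath 0 1
  have hcont := fun f g y => continuous_wignerKernel_path f g hpath y
  have hint := integral_sub_integral_eq_intervalIntegral
    (hasDerivAt_wignerKernel_update η m α v · ·)
    (fun y => ((hcont _ η y).add (hcont η _ y)).const_mul _ |>.add
      (((hcont _ η y).sub (hcont η _ y)).const_mul _))
    (integrable_wignerKernel_schwartz η η _) (integrable_wignerKernel_schwartz η η _)
    ((((hprod _ η).add (hprod η _)).const_mul _).add (((hprod _ η).sub (hprod η _)).const_mul _))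
  simpa [wigner] using hint

lemma norm_wigner_update_sub_wigner_le {α : ι → ℂ} {z : ℂ} {r : ℝ} (hα : ‖α m‖ ≤ r)
    (hz : ‖z‖ ≤ r) :
    ‖wigner (Function.update α m z) η - wigner α η‖ ≤
      4 * ‖z - α m‖ * ((eLpNorm η 2 volume).toReal *
        (eLpNorm (annihilation m η) 2 volume).toReal + r * (eLpNorm η 2 volume).toReal ^ 2) := by
  have hsegment : ∀ t ∈ Set.uIoc (0 : ℝ) 1, ‖α m + t * (z - α m)‖ ≤ r := fun t ht => by
    rw [Set.uIoc_of_le zero_le_one] at ht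
    exact mem_closedBall_zero_iff.1 ((convex_closedBall 0 r).add_smul_sub_mem
      (mem_closedBall_zero_iff.2 hα) (mem_closedBall_zero_iff.2 hz) ⟨ht.1.le, ht.2⟩)
  have hderiv : ∀ t ∈ Set.uIoc (0 : ℝ) 1,
      ‖∫ y, modeDeriv m (z - α m) (Function.update α m (α m + t * (z - α m))) η y‖ ≤
        4 * ‖z - α m‖ * ((eLpNorm η 2 volume).toReal *
          (eLpNorm (annihilation m η) 2 volume).toReal + r * (eLpNorm η 2 volume).toReal ^ 2) :=
    fun t ht => (norm_integral_modeDeriv_le η m _ _).trans <| by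
      rw [Function.update_self]
      gcongr
      exact hsegment t ht
  rw [← add_sub_cancel (α m) z, wigner_update_sub_wigner, add_sub_cancel]
  simpa using intervalIntegral.norm_integral_le_of_norm_le_const hderiv

end Lipschitz

/-! ### Energy bounds -/

section Energy

lemma sq_tsum_mul_le {X : Type*} (f g : X → ℝ≥0∞) :
    (∑' x, f x * g x) ^ 2 ≤ (∑' x, f x ^ 2) * ∑' x, g x ^ 2 := by
  let _ : MeasurableSpace X := ⊤
  simpa only [lintegral_count] using sq_lintegral_mul_le (μ := Measure.count)
    (measurable_from_top (f := f)).aemeasurable (measurable_from_top (f := g)).aemeasurable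

lemma le_mul_iInf_add {X : Type*} {f : X → ℝ≥0∞} {a b c : ℝ≥0∞} (hc : c ≠ 0) (hc' : c ≠ ∞)
    (h : ∀ x, a ≤ c * f x + b) : a ≤ c * (⨅ x, f x) + b := by
  rw [ENNReal.mul_iInf_of_ne hc hc', ENNReal.iInf_add]
  exact le_iInf h

lemma enorm_sub_le_sum_of_update {ι X E : Type*} [Fintype ι] [DecidableEq ι]
    [NormedAddCommGroup E] {F : (ι → X) → E} {c : ι → ℝ≥0∞} {α β : ι → X}
    (h : ∀ (t : Finset ι), ∀ m ∉ t,
      ‖F (Function.update (t.piecewise β α) m (β m)) - F (t.piecewise β α)‖ₑ ≤ c m) :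
    ‖F β - F α‖ₑ ≤ ∑ m, c m := by
  suffices hpartial : ∀ t : Finset ι, ‖F (t.piecewise β α) - F α‖ₑ ≤ ∑ m ∈ t, c m by
    simpa using hpartial Finset.univ
  intro t
  induction t using Finset.induction_on with
  | empty => simp
  | insert m t hm ih =>
    rw [Finset.sum_insert hm, Finset.piecewise_insert, ← sub_add_sub_cancel]
    exact (enorm_add_le _ _).trans (add_le_add (h t m hm) ih)

lemma norm_inner_sub_inner_le_of_mem_closure {H : Type*} [NormedAddCommGroup H]
    [InnerProductSpace ℂ H] {s : Set (H × H)} {B C : H →L[ℂ] H} {c r : ℝ}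
    (hs : ∀ q ∈ s,
      ‖⟪q.1, B q.1⟫_ℂ - ⟪q.1, C q.1⟫_ℂ‖ ≤ c * (‖q.1‖ * ‖q.2‖ + r * ‖q.1‖ ^ 2))
    {q : H × H} (hq : q ∈ closure s) :
    ‖⟪q.1, B q.1⟫_ℂ - ⟪q.1, C q.1⟫_ℂ‖ ≤ c * (‖q.1‖ * ‖q.2‖ + r * ‖q.1‖ ^ 2) := by
  have hclosed : IsClosed {q : H × H |
      ‖⟪q.1, B q.1⟫_ℂ - ⟪q.1, C q.1⟫_ℂ‖ ≤ c * (‖q.1‖ * ‖q.2‖ + r * ‖q.1‖ ^ 2)} :=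
    isClosed_le (by fun_prop) (by fun_prop)
  exact closure_minimal hs hclosed hq

variable {ι : Type} [Fintype ι] [DecidableEq ι]

/-- The norm `‖aₘ ψ‖`, which is `∞` if `ψ` is not in the domain of the closed operator `aₘ`. -/
def annihilationNorm (m : ι) (ψ : Space ι) : ℝ≥0∞ :=
  ⨅ φ : {φ // (ψ, φ) ∈ annihilationGraph m}, ‖φ.1‖ₑ

lemma annihilationNorm_sq (m : ι) (ψ : Space ι) : annihilationNorm m ψ ^ 2 = numberForm m ψ := by
  have hmap := (ENNReal.orderIsoRpow 2 two_pos).map_iInf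
    fun φ : {φ // (ψ, φ) ∈ annihilationGraph m} => ‖φ.1‖ₑ
  simp only [ENNReal.orderIsoRpow_apply, ENNReal.rpow_two] at hmap
  rw [annihilationNorm, hmap, numberForm, iInf_subtype']

lemma norm_inner_displacedParity_update_sub_le {ψ φ : Space ι} {m : ι}
    (h : (ψ, φ) ∈ annihilationGraph m) {α : ι → ℂ} {z : ℂ} {r : ℝ} (hα : ‖α m‖ ≤ r)
    (hz : ‖z‖ ≤ r) :
    ‖⟪ψ, displacedParity (Function.update α m z) ψ⟫_ℂ - ⟪ψ, displacedParity α ψ⟫_ℂ‖ ≤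
      4 * ‖z - α m‖ * (‖ψ‖ * ‖φ‖ + r * ‖ψ‖ ^ 2) := by
  refine norm_inner_sub_inner_le_of_mem_closure (q := (ψ, φ)) ?_ h
  rintro q ⟨η, hη, hφ⟩
  rw [← coe_annihilation] at hφ
  rw [inner_displacedParity, inner_displacedParity, wigner_congr _ hη, wigner_congr _ hη,
    Lp.norm_def, Lp.norm_def, eLpNorm_congr_ae hη, eLpNorm_congr_ae hφ]
  exact norm_wigner_update_sub_wigner_le η m hα hz

lemma enorm_inner_displacedParity_update_sub_le (ψ : Space ι) {m : ι} {α : ι → ℂ} {z : ℂ}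
    {r : ℝ} (hα : ‖α m‖ ≤ r) (hz : ‖z‖ ≤ r) :
    ‖⟪ψ, displacedParity (Function.update α m z) ψ⟫_ℂ - ⟪ψ, displacedParity α ψ⟫_ℂ‖ₑ ≤
      4 * ‖z - α m‖ₑ * (‖ψ‖ₑ * annihilationNorm m ψ + ENNReal.ofReal r * ‖ψ‖ₑ ^ 2) := by
  obtain rfl | hne := eq_or_ne z (α m)
  · simp
  obtain rfl | hψ := eq_or_ne ψ 0
  · simp
  rw [mul_add, ← mul_assoc]
  refine le_mul_iInf_add (by simp [sub_ne_zero.2 hne, hψ])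
    (by simp [ENNReal.mul_eq_top]) fun φ => ?_
  have hr : 0 ≤ r := (norm_nonneg _).trans hα
  have h := ENNReal.ofReal_le_ofReal (norm_inner_displacedParity_update_sub_le φ.2 hα hz)
  rw [ENNReal.ofReal_mul (by positivity), ENNReal.ofReal_add (by positivity) (by positivity),
    ENNReal.ofReal_mul (by positivity), ENNReal.ofReal_mul (by positivity),
    ENNReal.ofReal_mul hr, ENNReal.ofReal_pow (norm_nonneg _)] at h
  simpa only [ofReal_norm, ENNReal.ofReal_ofNat, mul_add, mul_assoc] using h

lemma enorm_inner_displacedParity_sub_le (ψ : Space ι) {α β : ι → ℂ} {r d : ℝ}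
    (hα : ∀ m, ‖α m‖ ≤ r) (hβ : ∀ m, ‖β m‖ ≤ r) (hd : ∀ m, ‖β m - α m‖ ≤ d) :
    ‖⟪ψ, displacedParity β ψ⟫_ℂ - ⟪ψ, displacedParity α ψ⟫_ℂ‖ₑ ≤
      ∑ m, 4 * ENNReal.ofReal d *
        (‖ψ‖ₑ * annihilationNorm m ψ + ENNReal.ofReal r * ‖ψ‖ₑ ^ 2) := by
  refine enorm_sub_le_sum_of_update (F := fun α => ⟪ψ, displacedParity α ψ⟫_ℂ)
    fun t m hm => ?_
  have hpiece : t.piecewise β α m = α m := Finset.piecewise_eq_of_notMem _ _ _ hm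
  refine (enorm_inner_displacedParity_update_sub_le ψ (hpiece ▸ hα m) (hβ m)).trans ?_
  rw [hpiece, ← ofReal_norm (β m - α m)]
  gcongr
  exact hd m

lemma IsState.sq_tsum_mul_annihilationNorm_le {ρ : Op ι} (hρ : IsState ρ) :
    (∑' i, ∑ m, ‖sqrtOp ρ (basis (Space ι) i)‖ₑ *
      annihilationNorm m (sqrtOp ρ (basis (Space ι) i))) ^ 2 ≤
        Fintype.card ι * totalEnergy ρ := by
  set ψ := fun i => sqrtOp ρ (basis (Space ι) i)
  have hnorm : ∑' q : _ × ι, ‖ψ q.1‖ₑ ^ 2 = Fintype.card ι := by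
    simp only [ENNReal.tsum_prod', tsum_fintype, Finset.sum_const, Finset.card_univ, nsmul_eq_mul,
      ENNReal.tsum_mul_left]
    rw [hρ.isEnsemble_sqrtOp.tsum_sq_enorm hρ.2, mul_one]
  have henergy : ∑' q : _ × ι, annihilationNorm q.2 (ψ q.1) ^ 2 = totalEnergy ρ := by
    simp only [annihilationNorm_sq]
    rw [ENNReal.tsum_prod', ENNReal.tsum_comm, tsum_fintype]
    rfl
  rw [← hnorm, ← henergy]
  refine le_trans (le_of_eq ?_) (sq_tsum_mul_le _ _)
  simp only [ENNReal.tsum_prod', tsum_fintype]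
  rfl

/- The weight `√(M E)` comes from Cauchy–Schwarz for the sum over the ensemble and the modes. -/
lemma IsState.enorm_trace_displacedParity_sub_le {ρ : Op ι} (hρ : IsState ρ) {α β : ι → ℂ}
    {r d : ℝ} (hα : ∀ m, ‖α m‖ ≤ r) (hβ : ∀ m, ‖β m‖ ≤ r) (hd : ∀ m, ‖β m - α m‖ ≤ d) :
    ‖trace (ρ ∘L displacedParity β) - trace (ρ ∘L displacedParity α)‖ₑ ≤
      4 * ENNReal.ofReal d * ((Fintype.card ι * totalEnergy ρ) ^ (2⁻¹ : ℝ) +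
        Fintype.card ι * ENNReal.ofReal r) := by
  set ψ := fun i => sqrtOp ρ (basis (Space ι) i)
  have hψ : IsEnsemble ρ ψ := hρ.isEnsemble_sqrtOp
  have hcauchy : ∑' i, ∑ m, ‖ψ i‖ₑ * annihilationNorm m (ψ i) ≤
      (Fintype.card ι * totalEnergy ρ) ^ (2⁻¹ : ℝ) := by
    rw [ENNReal.le_rpow_inv_iff two_pos, ENNReal.rpow_two]
    exact hρ.sq_tsum_mul_annihilationNorm_le
  have hsum := (hψ.hasSum_trace_comp (displacedParity β)).sub
    (hψ.hasSum_trace_comp (displacedParity α))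
  rw [← hsum.tsum_eq]
  calc _ ≤ ∑' i, ‖⟪ψ i, displacedParity β (ψ i)⟫_ℂ - ⟪ψ i, displacedParity α (ψ i)⟫_ℂ‖ₑ :=
        enorm_tsum_le_tsum_enorm
    _ ≤ ∑' i, ∑ m, 4 * ENNReal.ofReal d *
          (‖ψ i‖ₑ * annihilationNorm m (ψ i) + ENNReal.ofReal r * ‖ψ i‖ₑ ^ 2) :=
        ENNReal.tsum_le_tsum fun i => enorm_inner_displacedParity_sub_le (ψ i) hα hβ hd
    _ = 4 * ENNReal.ofReal d * ((∑' i, ∑ m, ‖ψ i‖ₑ * annihilationNorm m (ψ i)) +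
          ENNReal.ofReal r * Fintype.card ι) := by
        simp only [← Finset.mul_sum, Finset.sum_add_distrib, Finset.sum_const, Finset.card_univ,
          nsmul_eq_mul, ENNReal.tsum_mul_left, ENNReal.tsum_add, hψ.tsum_sq_enorm hρ.2, mul_one]
    _ ≤ _ := by rw [mul_comm (ENNReal.ofReal r)]; gcongr

end Energy

/-! ### Discretisation -/

section Grid

/-- The square cell of side `Δ` centred at the grid point `n`. -/
def gridCell (Δ : ℝ) (n : ℤ × ℤ) : Set (ℝ × ℝ) :=
  Metric.ball (n.1 * Δ) (Δ / 2) ×ˢ Metric.ball (n.2 * Δ) (Δ / 2)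

lemma measurableSet_gridCell (Δ : ℝ) (n : ℤ × ℤ) : MeasurableSet (gridCell Δ n) :=
  measurableSet_ball.prod measurableSet_ball

lemma volume_gridCell {Δ : ℝ} (hΔ : 0 ≤ Δ) (n : ℤ × ℤ) :
    volume (gridCell Δ n) = ENNReal.ofReal (Δ ^ 2) := by
  rw [gridCell, Measure.volume_eq_prod, Measure.prod_prod, Real.volume_ball, Real.volume_ball,
    mul_div_cancel₀ _ two_ne_zero, ← ENNReal.ofReal_mul hΔ, pow_two]

lemma pairwise_disjoint_ball_intCast_mul (Δ : ℝ) :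
    Pairwise (Function.onFun Disjoint fun k : ℤ => Metric.ball (k * Δ) (Δ / 2)) := by
  convert Set.pairwise_disjoint_Ioo_add_zsmul (-(Δ / 2)) Δ using 3 with k
  rw [Real.ball_eq_Ioo, zsmul_eq_mul, zsmul_eq_mul]
  push_cast
  congr 1 <;> ring

lemma pairwise_disjoint_gridCell (Δ : ℝ) : Pairwise (Function.onFun Disjoint (gridCell Δ)) := by
  intro n k hnk
  rw [Function.onFun, gridCell, gridCell, Set.disjoint_prod]
  obtain hne | hne := not_and_or.1 (hnk ∘ Prod.ext_iff.2)
  · exact .inl (pairwise_disjoint_ball_intCast_mul Δ hne)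
  · exact .inr (pairwise_disjoint_ball_intCast_mul Δ hne)

variable {M : ℕ}

lemma norm_gridPoint {Δ : ℝ} (hΔ : 0 ≤ Δ) (n : ℤ × ℤ) (m : Fin M) :
    ‖gridPoint M Δ n m‖ = √((n.1 : ℝ) ^ 2 + (n.2 : ℝ) ^ 2) * Δ := by
  have hpoint : (n.1 : ℂ) + Complex.I * n.2 = ⟨(n.1 : ℝ), (n.2 : ℝ)⟩ := by
    apply Complex.ext <;> simp
  rw [gridPoint, norm_mul, Complex.norm_real, Real.norm_of_nonneg hΔ, hpoint, Complex.norm_def,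
    Complex.normSq_mk, pow_two, pow_two]

lemma norm_diag_sub_gridPoint_le {Δ : ℝ} (hΔ : 0 ≤ Δ) {n : ℤ × ℤ} {p : ℝ × ℝ}
    (hp : p ∈ gridCell Δ n) (m : Fin M) :
    ‖diag (Fin M) p m - gridPoint M Δ n m‖ ≤ Δ / √2 := by
  obtain ⟨hre, him⟩ := hp
  rw [Metric.mem_ball, Real.dist_eq, abs_lt] at hre him
  have hdiff : diag (Fin M) p m - gridPoint M Δ n m = ⟨p.1 - n.1 * Δ, p.2 - n.2 * Δ⟩ := by
    apply Complex.ext <;> simp [diag, gridPoint]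
  rw [hdiff, Complex.norm_def, Complex.normSq_mk]
  refine Real.sqrt_le_iff.2 ⟨by positivity, ?_⟩
  rw [div_pow, Real.sq_sqrt zero_le_two]
  linarith [sq_lt_sq' hre.1 hre.2, sq_lt_sq' him.1 him.2]

/-- A bound on the variation of `tr[ρ Π(α (1, …, 1))]` over the cell at `n`, for energy at most
`E`: displacements differ by at most `d = Δ / √2` from the grid point, so that their absolute
values are at most `|n| Δ + d`. -/
def cellError (M : ℕ) (Δ E : ℝ) (n : ℤ × ℤ) : ℝ :=
  4 * (Δ / √2) * (√(M * E) + M * (√((n.1 : ℝ) ^ 2 + (n.2 : ℝ) ^ 2) * Δ + Δ / √2))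

lemma sq_mul_cellError (M : ℕ) (Δ E : ℝ) (n : ℤ × ℤ) :
    Δ ^ 2 * cellError M Δ E n = 2 * Δ ^ 3 * √(2 * M * E) +
      2 * M * Δ ^ 4 * (1 + √(2 * ((n.1 : ℝ) ^ 2 + (n.2 : ℝ) ^ 2))) := by
  have hsq : √2 * √2 = (2 : ℝ) := Real.mul_self_sqrt zero_le_two
  have hdiv : Δ / √2 = Δ * √2 / 2 := by
    rw [div_eq_div_iff (by positivity) two_ne_zero]
    linear_combination -Δ * hsq
  rw [cellError, hdiv, mul_assoc 2 (M : ℝ) E, Real.sqrt_mul zero_le_two, Real.sqrt_mul zero_le_two]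
  linear_combination M * Δ ^ 4 * hsq

lemma ofReal_rpow_inv_two (x : ℝ) : ENNReal.ofReal x ^ (2⁻¹ : ℝ) = ENNReal.ofReal √x := by
  obtain hx | hx := le_total 0 x
  · rw [ENNReal.ofReal_rpow_of_nonneg hx (by positivity), Real.sqrt_eq_rpow, one_div]
  · rw [Real.sqrt_eq_zero'.2 hx, ENNReal.ofReal_of_nonpos hx, ENNReal.ofReal_zero,
      ENNReal.zero_rpow_of_pos (by positivity)]

lemma ofReal_cellError {Δ : ℝ} (hΔ : 0 ≤ Δ) (M : ℕ) (E : ℝ) (n : ℤ × ℤ) :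
    ENNReal.ofReal (cellError M Δ E n) = 4 * ENNReal.ofReal (Δ / √2) *
      ((M * ENNReal.ofReal E) ^ (2⁻¹ : ℝ) +
        M * ENNReal.ofReal (√((n.1 : ℝ) ^ 2 + (n.2 : ℝ) ^ 2) * Δ + Δ / √2)) := by
  rw [cellError, ENNReal.ofReal_mul (by positivity), ENNReal.ofReal_mul zero_le_four,
    ENNReal.ofReal_ofNat, ENNReal.ofReal_add (by positivity) (by positivity),
    ← ofReal_rpow_inv_two, ENNReal.ofReal_mul (Nat.cast_nonneg M),
    ENNReal.ofReal_mul (Nat.cast_nonneg M), ENNReal.ofReal_natCast]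

variable {ρ : Op (Fin M)} {E Δ : ℝ}

lemma IsState.enorm_trace_gridPoint_le (hρ : IsState ρ)
    (henergy : totalEnergy ρ ≤ ENNReal.ofReal E) (hΔ : 0 ≤ Δ) {n : ℤ × ℤ} {p : ℝ × ℝ}
    (hp : p ∈ gridCell Δ n) :
    ‖trace (ρ ∘L displacedParity (gridPoint M Δ n))‖ₑ ≤
      ‖trace (ρ ∘L displacedParity (diag (Fin M) p))‖ₑ + ENNReal.ofReal (cellError M Δ E n) := by
  set d := Δ / √2
  set r := √((n.1 : ℝ) ^ 2 + (n.2 : ℝ) ^ 2) * Δ + d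
  have hd : 0 ≤ d := by positivity
  have hdist : ∀ m, ‖diag (Fin M) p m - gridPoint M Δ n m‖ ≤ d := norm_diag_sub_gridPoint_le hΔ hp
  have hgrid (m) : ‖gridPoint M Δ n m‖ ≤ r := by
    rw [norm_gridPoint hΔ]
    exact le_add_of_nonneg_right hd
  have hdiag (m) : ‖diag (Fin M) p m‖ ≤ r := by
    refine (norm_le_norm_add_norm_sub' _ (gridPoint M Δ n m)).trans ?_
    rw [norm_gridPoint hΔ]
    exact add_le_add_right (hdist m) _
  calc _ ≤ ‖trace (ρ ∘L displacedParity (diag (Fin M) p))‖ₑ +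
        ‖trace (ρ ∘L displacedParity (gridPoint M Δ n)) -
          trace (ρ ∘L displacedParity (diag (Fin M) p))‖ₑ := by
        simpa only [add_sub_cancel] using enorm_add_le
          (trace (ρ ∘L displacedParity (diag (Fin M) p)))
          (trace (ρ ∘L displacedParity (gridPoint M Δ n)) -
            trace (ρ ∘L displacedParity (diag (Fin M) p)))
    _ ≤ ‖trace (ρ ∘L displacedParity (diag (Fin M) p))‖ₑ + 4 * ENNReal.ofReal d *
          ((M * ENNReal.ofReal E) ^ (2⁻¹ : ℝ) + M * ENNReal.ofReal r) := by
        refine add_le_add_right ((hρ.enorm_trace_displacedParity_sub_le hdiag hgrid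
          fun m => norm_sub_rev (gridPoint M Δ n m) _ ▸ hdist m).trans ?_) _
        rw [Fintype.card_fin]
        gcongr
    _ = _ := by rw [ofReal_cellError hΔ]

lemma IsState.ofReal_trace_gridPoint_le (hρ : IsState ρ)
    (henergy : totalEnergy ρ ≤ ENNReal.ofReal E) (hΔ : 0 ≤ Δ) (n : ℤ × ℤ) :
    ENNReal.ofReal (Δ ^ 2 * ‖trace (ρ ∘L displacedParity (gridPoint M Δ n))‖) ≤
      (∫⁻ p in gridCell Δ n, ‖trace (ρ ∘L displacedParity (diag (Fin M) p))‖ₑ) +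
        ENNReal.ofReal (Δ ^ 2 * cellError M Δ E n) := by
  calc _ = ∫⁻ _ in gridCell Δ n, ‖trace (ρ ∘L displacedParity (gridPoint M Δ n))‖ₑ := by
        rw [setLIntegral_const, volume_gridCell hΔ, mul_comm, ENNReal.ofReal_mul (norm_nonneg _),
          ofReal_norm]
    _ ≤ ∫⁻ p in gridCell Δ n, (‖trace (ρ ∘L displacedParity (diag (Fin M) p))‖ₑ +
          ENNReal.ofReal (cellError M Δ E n)) :=
        setLIntegral_mono' (measurableSet_gridCell Δ n) fun p hp =>
          hρ.enorm_trace_gridPoint_le henergy hΔ hp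
    _ = _ := by
        rw [lintegral_add_right _ measurable_const, setLIntegral_const, volume_gridCell hΔ,
          mul_comm (ENNReal.ofReal (cellError M Δ E n)), ← ENNReal.ofReal_mul (sq_nonneg Δ)]

lemma IsState.discreteIntegral_le (hρ : IsState ρ) (henergy : totalEnergy ρ ≤ ENNReal.ofReal E)
    (hΔ : 0 ≤ Δ) (S : Set (ℤ × ℤ)) :
    discreteIntegral ρ Δ S ≤
      (∫⁻ p : ℝ × ℝ, ‖trace (ρ ∘L displacedParity (diag (Fin M) p))‖ₑ) +
        discreteError M Δ S E := by
  calc discreteIntegral ρ Δ S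
      ≤ ∑' n : S, ((∫⁻ p in gridCell Δ n, ‖trace (ρ ∘L displacedParity (diag (Fin M) p))‖ₑ) +
          ENNReal.ofReal (Δ ^ 2 * cellError M Δ E n)) :=
        ENNReal.tsum_le_tsum fun n => hρ.ofReal_trace_gridPoint_le henergy hΔ n
    _ = (∫⁻ p in ⋃ n : S, gridCell Δ n, ‖trace (ρ ∘L displacedParity (diag (Fin M) p))‖ₑ) +
          discreteError M Δ S E := by
        rw [ENNReal.tsum_add, lintegral_iUnion (fun n : S => measurableSet_gridCell Δ n)
          ((pairwise_disjoint_gridCell Δ).comp_of_injective Subtype.coe_injective)]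
        simp only [sq_mul_cellError, discreteError]
    _ ≤ _ := add_le_add_left (setLIntegral_le_lintegral _ _) _

end Grid

end CVSystem

end

theorem mainTheorem2 (M : ℕ) (hM : 2 ≤ M) (ρ : CVSystem.Op (Fin M)) (hρ : CVSystem.IsState ρ)
    (E : ℝ) (hE : 0 ≤ E) (henergy : CVSystem.totalEnergy ρ ≤ ENNReal.ofReal E)
    (Δ : ℝ) (hΔ : 0 < Δ) (S : Set (ℤ × ℤ))
    (hI : ENNReal.ofReal (Real.pi / (4 * Real.sqrt ((M : ℝ) - 1))) <
      CVSystem.discreteIntegral ρ Δ S - CVSystem.discreteError M Δ S E) :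
    CVSystem.IsGME ρ := by
  refine ⟨hρ, fun hmixture => hI.not_ge ?_⟩
  have hslice := hmixture.lintegral_enorm_trace_le hρ.2
  rw [Fintype.card_fin] at hslice
  exact (tsub_le_iff_right.2 (hρ.discreteIntegral_le henergy hΔ.le S)).trans hslice
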